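/- **Setup.** Let $N$ be a random variable with values in $\{1,2,\dots;\infty\}$ with law $d$, and let $H(z)=\sum_{n<\infty}\mathbb P(N=n)z^n$. Thus $H(0)=0$; assume that $H$ is strictly convex on $[0,1]$ (equivalently, $\mathbb P(2\le N<\infty)>0$). Let $\mathcal P$ be the set of probability measures on $[0,1]$ with the topology of weak convergence, and let $\mathcal T:\mathcal P\to\mathcal P$ send $\nu$ to the law of $1-\prod_{i=1}^N X_i$, where $X_1,X_2,\dots$ are i.i.d. with law $\nu$ and independent of $N$. For $\pi\in\mathcal P$ the basin of attraction of $\pi$ is $$B(\pi)=\{\nu\in\mathcal P:\ \mathcal T^n(\nu)\to\pi \text{ weakly as } n\to\infty\}.$$ Let $\delta$ denote the unique $\mathcal T$-invariant probability measure on $\{0,1\}$ and let $\mu^1=\delta(\{1\})$ be its mean. Let $\mathbf T=\bigcup_{n\ge 0}\mathbb N^n$ be the tree with infinite branching, with root $\emptyset$, where $|u|$ is the depth of $u$ and $u1,u2,\dots$ are the daughters of $u$, and let $(N_u)_{u\in\mathbf T}$ be i.i.d. with law $d$ on a probability space. A tree-indexed solution is a family $(X_u)_{u\in\mathbf T}$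 of $[0,1]$-valued random variables on this space, all with the same law, such that almost surely $X_u=1-\prod_{i=1}^{N_u}X_{ui}$ for every $u$, and such that for every $n$ the variables $(X_u;|u|=n)$ are mutually independent and independent of $(N_v;|v|\le n-1)$. It is endogenous if every $X_u$ is, up to a null set, measurable with respect to $\sigma(N_v;v\in\mathbf T)$. **Theorem 5.3** (basin of attraction, unstable case). Suppose that $H'(\mu^1)>1$. Then an endogenous tree-indexed solution $(C_u)_{u\in\mathbf T}$ exists and, for every such solution, the law $\varsigma$ of $C_\emptyset$ satisfies $$B(\varsigma)=\Big\{\nu\in\mathcal P:\ \int x\,d\nu(x)=\mu^1 \text{ and } \nu\ne\delta\Big\}.$$ That is, the basin of attraction of the law of the endogenous solution is exactly the set of laws on $[0,1]$ with mean $\mu^1$, except the two-point law on $\{0,1\}$ with mean $\mu^1$. -/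

import Mathlib

open MeasureTheory ProbabilityTheory Filter Topology unitInterval

namespace VetoVoter

noncomputable section

/-- The probability generating function `H(z) = ∑_{n < ∞} P(N = n) zⁿ` of a law `d` on
`{0, 1, 2, …; ∞}`. -/
def pgf (d : ProbabilityMeasure ℕ∞) (z : ℝ) : ℝ :=
  ∑' n : ℕ, (d : Measure ℕ∞).real {(n : ℕ∞)} * z ^ n

/-- The product of the first `n` terms of a sequence in `[0,1]` (of all its terms if `n = ∞`).
The indices start at `0`. -/
def prodFirst (n : ℕ∞) (x : ℕ → I) : I :=
  ∏' i : ℕ, if (i : ℕ∞) < n then x i else 1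

/-- Every infinite product of elements of `[0,1]` converges. -/
theorem multipliable_unitInterval (y : ℕ → I) : Multipliable y := by
  have hanti : Antitone (fun s : Finset ℕ => ∏ i ∈ s, y i) := by
    intro s t hst
    change ∏ i ∈ t, y i ≤ ∏ i ∈ s, y i
    rw [← Finset.prod_sdiff hst]
    exact unitInterval.mul_le_right
  exact ⟨_, by
    simpa [HasProd] using tendsto_atTop_iInf hanti⟩

theorem measurable_prodFirst : Measurable (fun p : ℕ∞ × (ℕ → I) => prodFirst p.1 p.2) := by
  refine measurable_of_tendsto_metrizable
    (f := fun (k : ℕ) (p : ℕ∞ × (ℕ → I)) =>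
      ∏ i ∈ Finset.range k, if (i : ℕ∞) < p.1 then p.2 i else 1) ?_ ?_
  · intro k
    refine Finset.measurable_prod _ fun i _ => ?_
    refine Measurable.ite ?_ (by fun_prop) measurable_const
    exact measurable_fst (MeasurableSet.of_discrete (s := {n : ℕ∞ | (i : ℕ∞) < n}))
  · rw [tendsto_pi_nhds]
    intro p
    exact (multipliable_unitInterval _).hasProd.tendsto_prod_nat

/-- The right-hand side `1 - ∏_{i ≤ n} x_i` of the recursion. -/
def step (n : ℕ∞) (x : ℕ → I) : I := σ (prodFirst n x)

theorem measurable_step : Measurable (fun p : ℕ∞ × (ℕ → I) => step p.1 p.2) :=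
  unitInterval.continuous_symm.measurable.comp measurable_prodFirst

/-- The distributional map `𝒯`: `𝒯(ν)` is the law of `1 - ∏_{i=1}^N X_i`, where `N` has law `d`
and the `X_i` are i.i.d. with law `ν` and independent of `N`. -/
def distMap (d : ProbabilityMeasure ℕ∞) (ν : ProbabilityMeasure I) : ProbabilityMeasure I :=
  ⟨((d : Measure ℕ∞).prod (Measure.infinitePi fun _ : ℕ => (ν : Measure I))).map
      (fun p => step p.1 p.2),
    Measure.isProbabilityMeasure_map measurable_step.aemeasurable⟩

/-- The basin of attraction of `π` under `𝒯`, for weak convergence of laws on `[0,1]`. -/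
def basin (d : ProbabilityMeasure ℕ∞) (π : ProbabilityMeasure I) : Set (ProbabilityMeasure I) :=
  {ν | Tendsto (fun n : ℕ => (distMap d)^[n] ν) atTop (𝓝 π)}

/-- The law on `{0,1}` with mean `m`. -/
def twoPoint (m : I) : ProbabilityMeasure I :=
  ⟨ENNReal.ofReal (m : ℝ) • Measure.dirac 1 + ENNReal.ofReal (1 - (m : ℝ)) • Measure.dirac 0, by
    constructor
    simp only [Measure.coe_add, Measure.coe_smul, Pi.add_apply, Pi.smul_apply, measure_univ,
      smul_eq_mul, mul_one]
    rw [← ENNReal.ofReal_add m.2.1 (sub_nonneg.2 m.2.2)]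
    simp⟩

/-- `X` is a tree-indexed solution of `X_u = 1 - ∏_{i=1}^{N_u} X_{ui}`. The nodes of the tree are
the finite sequences of natural numbers, `[]` is the root, and the daughters of `u` are the
`u ++ [i]`. -/
structure IsTreeSolution {Ω : Type*} [MeasurableSpace Ω] (P : Measure Ω)
    (N : List ℕ → Ω → ℕ∞) (X : List ℕ → Ω → I) : Prop where
  measurable : ∀ u, Measurable (X u)
  indep_level : ∀ n : ℕ, iIndepFun (fun u : {u : List ℕ // u.length = n} => X u) P
  indep_above : ∀ n : ℕ,
    IndepFun (fun ω (u : {u : List ℕ // u.length = n}) => X u ω)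
      (fun ω (v : {v : List ℕ // v.length < n}) => N v ω) P
  recursion : ∀ u, ∀ᵐ ω ∂P, X u ω = step (N u ω) (fun i => X (u ++ [i]) ω)
  stationary : ∀ u, P.map (X u) = P.map (X [])

/-- A tree-indexed solution is endogenous if each `X_u` is (up to a null set) measurable with
respect to the `σ`-algebra generated by all the family sizes `N_v`. -/
structure IsEndogenousSolution {Ω : Type*} [MeasurableSpace Ω] (P : Measure Ω)
    (N : List ℕ → Ω → ℕ∞) (X : List ℕ → Ω → I) : Prop extends IsTreeSolution P N X where
  endogenous : ∀ u, ∃ Y : Ω → I,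
    Measurable[⨆ v, MeasurableSpace.comap (N v) inferInstance] Y ∧ X u =ᵐ[P] Y

end

end VetoVoter

namespace VetoVoter

/-! ### The generating function -/

section Pgf

/-! The argument is run on moments, which determine a law on $[0,1]$ and its weak limits. If $\nu$
has mean below $1$, expanding $(1-\prod X_i)^k$ and conditioning on $N$ writes the $k$-th moment of
$\mathcal T(\nu)$ through $H$ of the moments of $\nu$ of order at most $k$. The mean thus evolves by
$x\mapsto 1-H(x)$, with unique fixed point $m=\mu^1$. Once the mean is $m$, the second moment
evolves by $x\mapsto 2m-1+H(x)$.

Let $\varsigma$ be an invariant law other than $\delta$. The last map fixes $m$ and the smaller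
second moment of $\varsigma$. Strict convexity makes it contract below $m$, and every law of mean
$m$ except $\delta$ starts there. Moments of order $k\ge 2$ lie below the second one, so induction
on $k$ gives convergence of all of them (`tendsto_iterate_of_mean`). Conversely, if the iterates
tend to $\varsigma$, their means tend to a point where $x\mapsto 1-H(x)$ is expanding, so they
eventually equal $m$; injectivity of $H$ carries this back to $\nu$ (`basin_eq_of_distMap_eq`).

An endogenous solution is the limit of the bounded martingale obtained by putting $m$ at depth $n$
and running the recursion upwards (`isEndogenousSolution_limitSolution`). By Lévy's upward theorem
the root of every such solution is this limit. Its law is not $\delta$, since $H'(m)>1$ keeps the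
second moments of the martingale away from $m$ (`IsEndogenousSolution.ne_twoPoint`). -/

theorem summable_weights (d : ProbabilityMeasure ℕ∞) :
    Summable (fun n : ℕ => (d : Measure ℕ∞).real {(n : ℕ∞)}) := by
  refine summable_measure_toReal (fun _ => MeasurableSet.singleton _) ?_
  intro i j hij
  simpa [Function.onFun] using hij

theorem summable_pgf (d : ProbabilityMeasure ℕ∞) {z : ℝ} (h0 : 0 ≤ z) (h1 : z ≤ 1) :
    Summable (fun n : ℕ => (d : Measure ℕ∞).real {(n : ℕ∞)} * z ^ n) :=
  (summable_weights d).of_nonneg_of_le (fun _ => by positivity)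
    (fun _ => mul_le_of_le_one_right measureReal_nonneg (pow_le_one₀ h0 h1))

theorem pgf_monotoneOn (d : ProbabilityMeasure ℕ∞) : MonotoneOn (pgf d) (Set.Icc 0 1) := by
  intro x hx y hy hxy
  refine (summable_pgf d hx.1 hx.2).tsum_le_tsum (fun n => ?_) (summable_pgf d hy.1 hy.2)
  have := hx.1
  gcongr

theorem pgf_continuousOn (d : ProbabilityMeasure ℕ∞) : ContinuousOn (pgf d) (Set.Icc 0 1) := by
  refine continuousOn_tsum (fun n => by fun_prop) (summable_weights d) ?_
  intro n x hx
  rw [Real.norm_of_nonneg (mul_nonneg measureReal_nonneg (pow_nonneg hx.1 _))]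
  exact mul_le_of_le_one_right measureReal_nonneg (pow_le_one₀ hx.1 hx.2)

theorem strictMonoOn_of_monotoneOn_of_strictConvexOn {f : ℝ → ℝ} {s : Set ℝ}
    (hm : MonotoneOn f s) (hc : StrictConvexOn ℝ s f) : StrictMonoOn f s := by
  intro x hx y hy hxy
  refine lt_of_le_of_ne (hm hx hy hxy.le) fun heq => ?_
  have h : f ((1 / 2 : ℝ) • x + (1 / 2 : ℝ) • y) < (1 / 2 : ℝ) • f x + (1 / 2 : ℝ) • f y :=
    hc.2 hx hy hxy.ne (by norm_num) (by norm_num) (by norm_num)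
  have hmid : (1 / 2 : ℝ) • x + (1 / 2 : ℝ) • y ∈ s :=
    hc.1 hx hy (by norm_num) (by norm_num) (by norm_num)
  have h2 := hm hx hmid (by simp only [smul_eq_mul]; linarith)
  simp only [smul_eq_mul] at h h2
  linarith

theorem exists_expanding_of_one_lt_deriv {f : ℝ → ℝ} {a : ℝ} (h : 1 < deriv f a) :
    ∃ c : ℝ, 1 < c ∧ ∀ᶠ x in 𝓝 a, c * |x - a| ≤ |f x - f a| := by
  -- `deriv` is $0$ where no derivative exists, so a value above $1$ already gives
  -- differentiability.
  have hd : HasDerivAt f (deriv f a) a :=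
    (differentiableAt_of_deriv_ne_zero (by linarith : deriv f a ≠ 0)).hasDerivAt
  obtain ⟨c, hc1, hc2⟩ := exists_between h
  refine ⟨c, hc1, ?_⟩
  have hs := (hasDerivAt_iff_tendsto_slope.1 hd).eventually (lt_mem_nhds hc2)
  rw [eventually_nhdsWithin_iff] at hs
  filter_upwards [hs] with x hx
  rcases eq_or_ne x a with rfl | hxa
  · simp
  have h1 := hx hxa
  rw [slope_def_field] at h1
  have h2 : c ≤ |f x - f a| / |x - a| := by
    rw [← abs_div]; exact h1.le.trans (le_abs_self _)
  rwa [le_div_iff₀ (abs_pos.2 (sub_ne_zero.2 hxa))] at h2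

/-- A sequence that converges to a point and is eventually an orbit of a map that expands distances
to that point is eventually constant. -/
theorem eventually_eq_of_tendsto_of_expanding {f : ℝ → ℝ} {a c : ℝ} (hc : 1 < c)
    (hf : ∀ᶠ x in 𝓝 a, c * |x - a| ≤ |f x - f a|) {m : ℕ → ℝ} (hm : Tendsto m atTop (𝓝 a))
    (hrec : ∀ᶠ n in atTop, |m (n + 1) - a| = |f (m n) - f a|) : ∀ᶠ n in atTop, m n = a := by
  obtain ⟨n₀, hn₀⟩ := eventually_atTop.1 (hrec.and (hm.eventually hf))
  refine eventually_atTop.2 ⟨n₀, fun n hn => ?_⟩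
  by_contra hne
  have hpos : 0 < |m n - a| := abs_pos.2 (sub_ne_zero.2 hne)
  have hgrow : ∀ k : ℕ, |m n - a| ≤ |m (n + k) - a| := by
    intro k
    induction k with
    | zero => simp
    | succ k ih =>
      obtain ⟨h1, h2⟩ := hn₀ (n + k) (by omega)
      rw [← add_assoc, h1]
      refine ih.trans (le_trans ?_ h2)
      exact le_mul_of_one_le_left (abs_nonneg _) hc.le
  have hlim : Tendsto (fun k => |m (n + k) - a|) atTop (𝓝 0) := by
    have : Tendsto (fun k => m (n + k)) atTop (𝓝 a) := by
      simpa only [add_comm n] using (tendsto_add_atTop_iff_nat n).2 hm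
    simpa using (this.sub_const a).abs
  exact absurd (ge_of_tendsto' hlim hgrow) (not_le.2 hpos)

theorem tendsto_zero_of_le_mul_add {u e : ℕ → ℝ} {ρ : ℝ} (h0 : 0 ≤ ρ) (hρ : ρ < 1)
    (hu : ∀ n, 0 ≤ u n) (he : Tendsto e atTop (𝓝 0))
    (hrec : ∀ᶠ n in atTop, u (n + 1) ≤ ρ * u n + e n) : Tendsto u atTop (𝓝 0) := by
  refine tendsto_order.2 ⟨fun a ha => Eventually.of_forall fun n => ha.trans_le (hu n), ?_⟩
  intro a ha
  -- With errors below this bound, the level $a/2$ is kept by $x\mapsto\rho x+e$, and the excess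
  -- over it shrinks by the factor $\rho$.
  have hε : 0 < (1 - ρ) * (a / 2) := mul_pos (by linarith) (by linarith)
  obtain ⟨n₀, hn₀⟩ := eventually_atTop.1 (hrec.and (he.eventually (gt_mem_nhds hε)))
  have hgeom : ∀ k, u (n₀ + k) - a / 2 ≤ ρ ^ k * u n₀ := by
    intro k
    induction k with
    | zero => simp; linarith
    | succ k ih =>
      obtain ⟨h1, h2⟩ := hn₀ (n₀ + k) (by omega)
      have h3 := mul_le_mul_of_nonneg_left ih h0
      rw [pow_succ, ← add_assoc]
      nlinarith
  have hlim : Tendsto (fun k : ℕ => ρ ^ k * u n₀) atTop (𝓝 0) := by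
    simpa using (tendsto_pow_atTop_nhds_zero_of_lt_one h0 hρ).mul_const (u n₀)
  obtain ⟨k₀, hk₀⟩ := eventually_atTop.1
    (hlim.eventually (gt_mem_nhds (show (0 : ℝ) < a / 2 by linarith)))
  refine eventually_atTop.2 ⟨n₀ + k₀, fun n hn => ?_⟩
  obtain ⟨k, rfl⟩ := Nat.exists_eq_add_of_le hn
  have h1 := hgeom (k₀ + k)
  have h2 := hk₀ (k₀ + k) (by omega)
  rw [← add_assoc] at h1
  linarith

/-- If `H` is increasing and strictly convex and `a ↦ c + H a` has the two fixed points `s < m`,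
then `H` is a contraction on some `[0, b]` with `b < m` into which all orbits starting below `m`
finally fall. -/
theorem exists_contraction_below {H : ℝ → ℝ} {s m c : ℝ}
    (hmono : MonotoneOn H (Set.Icc 0 1)) (hconv : StrictConvexOn ℝ (Set.Icc 0 1) H)
    (hcont : ContinuousOn H (Set.Icc 0 1)) (hs0 : 0 ≤ s) (hsm : s < m) (hm1 : m ≤ 1)
    (hs : c + H s = s) (hm : c + H m = m) :
    ∃ b ρ : ℝ, s ≤ b ∧ b < m ∧ 0 ≤ ρ ∧ ρ < 1 ∧
      (∀ x ∈ Set.Icc 0 b, ∀ y ∈ Set.Icc 0 b, |H x - H y| ≤ ρ * |x - y|) ∧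
      ∀ a : ℕ → ℝ, (∀ n, 0 ≤ a n) → a 0 < m → (∀ n, a (n + 1) = c + H (a n)) →
        ∀ᶠ n in atTop, a n ≤ b := by
  -- The chord of $H$ over $[s,m]$ has slope exactly $1$, so shorter chords from $s$ are flatter.
  have hsec : ∀ x, s < x → x < m → (H x - H s) / (x - s) < 1 := by
    intro x hx1 hx2
    have h := hconv.secant_strict_mono (a := s) (x := x) (y := m) ⟨hs0, by linarith⟩
      ⟨by linarith, by linarith⟩ ⟨by linarith, hm1⟩ hx1.ne' hsm.ne' hx2
    have : (H m - H s) / (m - s) = 1 := by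
      rw [div_eq_one_iff_eq (by linarith)]; linarith
    linarith
  obtain ⟨b', hb'1, hb'2⟩ := exists_between hsm
  have hb's : H b' - H s < b' - s := by
    have := hsec b' hb'1 hb'2
    rwa [div_lt_one (by linarith)] at this
  have hcs : ContinuousWithinAt H (Set.Icc 0 1) s := hcont s ⟨hs0, by linarith⟩
  have hcs' : Tendsto H (𝓝[>] s) (𝓝 (H s)) :=
    hcs.mono_left (nhdsWithin_le_of_mem (mem_of_superset (Ioo_mem_nhdsGT (by linarith : s < 1))
      (fun x hx => ⟨by linarith [hx.1], hx.2.le⟩)))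
  -- The left end of the chord is moved slightly to the right of $s$, keeping its slope below $1$.
  -- By convexity this slope bounds all slopes on $[0,b]$; the gap $s<b$ lets orbits enter $[0,b]$
  -- in finite time.
  have hev : ∀ᶠ b in 𝓝[>] s, H b' - H b < b' - b := by
    have hl : Tendsto (fun b => (b' - b) - (H b' - H b)) (𝓝[>] s)
        (𝓝 ((b' - s) - (H b' - H s))) :=
      ((tendsto_const_nhds.sub (tendsto_id.mono_left nhdsWithin_le_nhds)).sub
        (tendsto_const_nhds.sub hcs'))
    filter_upwards [hl.eventually (lt_mem_nhds (show (0:ℝ) < _ by linarith))] with b hb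
    linarith
  obtain ⟨b, hb, hbs, hbb'⟩ := (hev.and (Ioo_mem_nhdsGT hb'1)).exists
  have hbI : b ∈ Set.Icc (0 : ℝ) 1 := ⟨by linarith, by linarith⟩
  have hb'I : b' ∈ Set.Icc (0 : ℝ) 1 := ⟨by linarith, by linarith⟩
  set ρ := (H b' - H b) / (b' - b) with hρ
  have hρ0 : 0 ≤ ρ := div_nonneg (sub_nonneg.2 (hmono hbI hb'I hbb'.le)) (by linarith)
  have hρ1 : ρ < 1 := by rw [hρ, div_lt_one (by linarith)]; exact hb
  have hlip : ∀ x ∈ Set.Icc 0 b, ∀ y ∈ Set.Icc 0 b, x ≤ y → |H x - H y| ≤ ρ * |x - y| := by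
    intro x hx y hy hxy
    have hxI : x ∈ Set.Icc (0 : ℝ) 1 := ⟨hx.1, by linarith [hx.2]⟩
    have hyI : y ∈ Set.Icc (0 : ℝ) 1 := ⟨hy.1, by linarith [hy.2]⟩
    rcases hxy.eq_or_lt with rfl | hlt
    · simp
    rw [abs_sub_comm, abs_of_nonneg (sub_nonneg.2 (hmono hxI hyI hxy)), abs_sub_comm,
      abs_of_nonneg (by linarith), ← div_le_iff₀ (by linarith)]
    have h1 := hconv.convexOn.slope_mono_adjacent hxI hb'I hlt (hy.2.trans_lt hbb')
    have h2 : (H b' - H y) / (b' - y) ≤ ρ := by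
      rcases hy.2.eq_or_lt with rfl | hyb
      · exact le_rfl
      have := hconv.convexOn.secant_mono hb'I hyI hbI (by linarith : y < b').ne hbb'.ne hyb.le
      rwa [← neg_sub (H b'), ← neg_sub b', neg_div_neg_eq, ← neg_sub (H b'), ← neg_sub b',
        neg_div_neg_eq] at this
    exact h1.trans h2
  refine ⟨b, ρ, hbs.le, by linarith, hρ0, hρ1, ?_, ?_⟩
  · intro x hx y hy
    rcases le_total x y with h | h
    · exact hlip x hx y hy h
    · rw [abs_sub_comm (H x), abs_sub_comm x]; exact hlip y hy x hx h
  · intro a ha0 ham harec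
    -- The orbit stays in $[0,t]$, where its excess over $s$ shrinks by the slope $r$ of the chord
    -- over $[s,t]$. Positive parts are taken since the orbit may lie below $s$.
    set t := max (a 0) b with ht
    have htm : t < m := max_lt ham (by linarith)
    have hst : s < t := hbs.trans_le (le_max_right _ _)
    set r := (H t - H s) / (t - s) with hr
    have hr1 : r < 1 := hsec t hst htm
    have hsI : s ∈ Set.Icc (0 : ℝ) 1 := ⟨hs0, by linarith⟩
    have htI : t ∈ Set.Icc (0 : ℝ) 1 := ⟨by linarith, by linarith⟩
    have hr0 : 0 ≤ r := div_nonneg (sub_nonneg.2 (hmono hsI htI hst.le)) (by linarith)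
    have hstep : ∀ x, 0 ≤ x → x ≤ t → c + H x - s ≤ r * max (x - s) 0 := by
      intro x hx0 hxt
      have hxI : x ∈ Set.Icc (0 : ℝ) 1 := ⟨hx0, by linarith⟩
      rcases le_or_gt x s with hxs | hxs
      · have := hmono hxI hsI hxs
        have h0 : 0 ≤ r * max (x - s) 0 := mul_nonneg hr0 (le_max_right _ _)
        linarith
      · rw [max_eq_left (by linarith)]
        have := hconv.convexOn.secant_mono hsI hxI htI hxs.ne' hst.ne' hxt
        rw [div_le_iff₀ (by linarith)] at this
        linarith
    have hall : ∀ n, max (a n - s) 0 ≤ r ^ n * (t - s) := by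
      intro n
      induction n with
      | zero =>
        simp only [pow_zero, one_mul]
        exact max_le (by linarith [le_max_left (a 0) b]) (by linarith)
      | succ n ih =>
        have h1 : r ^ n * (t - s) ≤ t - s :=
          mul_le_of_le_one_left (by linarith) (pow_le_one₀ hr0 hr1.le)
        have h2 : a n ≤ t := by linarith [le_max_left (a n - s) 0]
        refine max_le ?_ (mul_nonneg (pow_nonneg hr0 _) (by linarith))
        rw [harec]
        refine (hstep _ (ha0 n) h2).trans ?_
        rw [pow_succ, mul_comm (r ^ n), mul_assoc]
        exact mul_le_mul_of_nonneg_left ih hr0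
    have hlim : Tendsto (fun n : ℕ => r ^ n * (t - s)) atTop (𝓝 0) := by
      simpa using (tendsto_pow_atTop_nhds_zero_of_lt_one hr0 hr1).mul_const (t - s)
    filter_upwards [hlim.eventually (gt_mem_nhds (show (0 : ℝ) < b - s by linarith))] with n hn
    linarith [hall n, le_max_left (a n - s) 0]

end Pgf

/-! ### Products of the first terms of a sequence -/

section ProdFirst

theorem tendsto_prodFirst (n : ℕ∞) (x : ℕ → I) :
    Tendsto (fun k => ∏ i ∈ Finset.range k, if (i : ℕ∞) < n then x i else 1) atTop
      (𝓝 (prodFirst n x)) :=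
  (multipliable_unitInterval _).hasProd.tendsto_prod_nat

theorem prodFirst_natCast (n : ℕ) (x : ℕ → I) :
    prodFirst n x = ∏ i ∈ Finset.range n, x i := by
  rw [prodFirst, tprod_eq_prod (s := Finset.range n)]
  · refine Finset.prod_congr rfl fun i hi => ?_
    rw [if_pos (by exact_mod_cast Finset.mem_range.1 hi)]
  · intro i hi
    rw [if_neg (by simpa using hi)]

theorem tendsto_prodFirst_top (x : ℕ → I) :
    Tendsto (fun k => ∏ i ∈ Finset.range k, x i) atTop (𝓝 (prodFirst ⊤ x)) := by
  simpa using tendsto_prodFirst ⊤ x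

theorem prodFirst_top_le (x : ℕ → I) (k : ℕ) : prodFirst ⊤ x ≤ ∏ i ∈ Finset.range k, x i := by
  refine Antitone.le_of_tendsto (antitone_nat_of_succ_le fun k => ?_) (tendsto_prodFirst_top x) k
  rw [Finset.prod_range_succ]
  exact unitInterval.mul_le_left

theorem prodFirst_pow (n : ℕ∞) (x : ℕ → I) (j : ℕ) :
    prodFirst n x ^ j = prodFirst n (fun i => x i ^ j) := by
  refine tendsto_nhds_unique ((tendsto_prodFirst n x).pow j) ?_
  convert tendsto_prodFirst n (fun i => x i ^ j) using 2 with k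
  rw [← Finset.prod_pow]
  refine Finset.prod_congr rfl fun i _ => ?_
  split_ifs <;> simp

theorem prodFirst_top_const {m : I} (hm : (m : ℝ) < 1) : prodFirst ⊤ (fun _ => m) = 0 := by
  refine tendsto_nhds_unique (tendsto_prodFirst_top _) ?_
  rw [tendsto_subtype_rng]
  simpa using tendsto_pow_atTop_nhds_zero_of_lt_one m.2.1 hm

theorem coe_prodFirst_natCast_const (n : ℕ) (m : I) :
    ((prodFirst n (fun _ => m) : I) : ℝ) = (m : ℝ) ^ n := by
  simp [prodFirst_natCast]

theorem measurable_prodFirst_apply (n : ℕ∞) : Measurable (fun x : ℕ → I => prodFirst n x) :=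
  measurable_prodFirst.comp (measurable_const.prodMk measurable_id)

theorem integrable_coe_unitInterval {Ω : Type*} [MeasurableSpace Ω] {P : Measure Ω}
    [IsFiniteMeasure P] {Y : Ω → I} (hY : Measurable Y) : Integrable (fun ω => (Y ω : ℝ)) P := by
  refine Integrable.of_bound (by fun_prop) 1 (ae_of_all _ fun ω => ?_)
  rw [Real.norm_of_nonneg (Y ω).2.1]
  exact (Y ω).2.2

/-- The mean of a `[0,1]`-valued random variable, as an element of `[0,1]`. -/
noncomputable def expect {Ω : Type*} [MeasurableSpace Ω] (P : Measure Ω) [IsProbabilityMeasure P]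
    (Y : Ω → I) : I :=
  ⟨∫ ω, (Y ω : ℝ) ∂P, integral_nonneg fun ω => (Y ω).2.1, by
    by_cases h : Integrable (fun ω => (Y ω : ℝ)) P
    · simpa using integral_mono h (integrable_const 1) fun ω => (Y ω).2.2
    · rw [integral_undef h]; exact zero_le_one⟩

/-- Independence handles the partial products; dominated convergence passes to infinitely many
factors. -/
theorem integral_prodFirst {Ω : Type*} [MeasurableSpace Ω] {P : Measure Ω}
    [IsProbabilityMeasure P] {Y : ℕ → Ω → I} (hY : ∀ i, Measurable (Y i)) (hind : iIndepFun Y P)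
    (n : ℕ∞) :
    ∫ ω, (prodFirst n (fun i => Y i ω) : ℝ) ∂P = prodFirst n (fun i => expect P (Y i)) := by
  have h1 : Tendsto (fun k => ∫ ω, ((∏ i ∈ Finset.range k,
      if (i : ℕ∞) < n then Y i ω else 1 : I) : ℝ) ∂P) atTop
      (𝓝 (∫ ω, (prodFirst n (fun i => Y i ω) : ℝ) ∂P)) := by
    refine tendsto_integral_of_dominated_convergence (fun _ => 1) (fun k => ?_)
      (integrable_const 1) (fun k => ae_of_all _ fun ω => ?_) (ae_of_all _ fun ω => ?_)
    · refine Measurable.aestronglyMeasurable (measurable_subtype_coe.comp ?_)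
      refine Finset.measurable_prod _ fun i _ => ?_
      split_ifs
      exacts [hY i, measurable_const]
    · rw [Real.norm_of_nonneg (unitInterval.nonneg _)]
      exact unitInterval.le_one _
    · exact (continuous_subtype_val.tendsto _).comp (tendsto_prodFirst n _)
  refine tendsto_nhds_unique h1 ?_
  convert (continuous_subtype_val.tendsto _).comp
    (tendsto_prodFirst n (fun i => expect P (Y i))) using 2 with k
  have h2 : iIndepFun (fun (i : ℕ) ω => ((if (i : ℕ∞) < n then Y i ω else 1 : I) : ℝ)) P := by
    refine hind.comp (fun (i : ℕ) y => ((if (i : ℕ∞) < n then y else 1 : I) : ℝ)) fun i => ?_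
    split_ifs <;> fun_prop
  have h3 := iIndepFun.integral_fun_prod_eq_prod_integral
    (h2.precomp (g := fun i : Fin k => (i : ℕ)) Fin.val_injective)
    (fun i => by
      have := hY i
      split_ifs <;> fun_prop)
  simp only [Function.comp_apply]
  have hcoe : ∀ f : ℕ → I, ((∏ i ∈ Finset.range k, f i : I) : ℝ) = ∏ i : Fin k, (f i : ℝ) := by
    intro f
    rw [Finset.prod_range (fun i => f i)]
    exact map_prod (Submonoid.subtype unitInterval.submonoid) _ _
  simp_rw [hcoe]
  rw [h3]
  refine Finset.prod_congr rfl fun i _ => ?_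
  split_ifs
  · rfl
  · simp

/-- The atom of $N$ at $\infty$ contributes $m^\infty=0$, which is why $H$ omits it. At $m=1$ it
would contribute, so mean $1$ is treated separately throughout. -/
theorem integral_prodFirst_const (d : ProbabilityMeasure ℕ∞) {m : I} (hm : (m : ℝ) < 1) :
    ∫ n, (prodFirst n (fun _ => m) : ℝ) ∂(d : Measure ℕ∞) = pgf d m := by
  rw [integral_countable (integrable_coe_unitInterval Measurable.of_discrete), pgf]
  rw [← (Nat.cast_injective (R := ℕ∞)).tsum_eq]
  · simp [coe_prodFirst_natCast_const]
  · intro n hn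
    induction n using ENat.recTopCoe with
    | top => simp [prodFirst_top_const hm] at hn
    | coe n => exact ⟨n, rfl⟩

end ProdFirst

/-! ### Moments of the distributional map -/

section Moments

/-- The `k`-th moment of a law on `[0,1]`. -/
noncomputable def moment (ν : ProbabilityMeasure I) (k : ℕ) : I :=
  expect (ν : Measure I) (fun x => x ^ k)

theorem coe_moment (ν : ProbabilityMeasure I) (k : ℕ) :
    (moment ν k : ℝ) = ∫ x, (x : ℝ) ^ k ∂(ν : Measure I) := by
  simp [moment, expect]

theorem integrable_pow (ν : ProbabilityMeasure I) (k : ℕ) :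
    Integrable (fun x : I => (x : ℝ) ^ k) (ν : Measure I) := by
  simpa using integrable_coe_unitInterval (P := (ν : Measure I)) (Y := fun x => x ^ k)
    (by fun_prop)

theorem moment_anti (ν : ProbabilityMeasure I) : Antitone (moment ν) := by
  intro j k hjk
  rw [← Subtype.coe_le_coe, coe_moment, coe_moment]
  exact integral_mono (integrable_pow ν k) (integrable_pow ν j)
    fun x => pow_le_pow_of_le_one x.2.1 x.2.2 hjk

theorem integral_prodFirst_pow (d : ProbabilityMeasure ℕ∞) (ν : ProbabilityMeasure I) (j : ℕ) :
    ∫ p, (prodFirst p.1 p.2 : ℝ) ^ j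
        ∂((d : Measure ℕ∞).prod (Measure.infinitePi fun _ : ℕ => (ν : Measure I))) =
      ∫ n, (prodFirst n (fun _ => moment ν j) : ℝ) ∂(d : Measure ℕ∞) := by
  have hpow : ∀ p : ℕ∞ × (ℕ → I),
      (prodFirst p.1 p.2 : ℝ) ^ j = ((prodFirst p.1 p.2 ^ j : I) : ℝ) := fun p => rfl
  simp_rw [hpow]
  rw [integral_prod]
  · refine integral_congr_ae (ae_of_all _ fun n => ?_)
    simp only [prodFirst_pow]
    rw [integral_prodFirst (Y := fun i (x : ℕ → I) => x i ^ j) (fun i => by fun_prop)]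
    · congr! 3 with i
      rw [← Subtype.coe_inj]
      simp only [moment, expect]
      conv_rhs => rw [← Measure.infinitePi_map_eval (fun _ : ℕ => (ν : Measure I)) i]
      rw [integral_map (measurable_pi_apply i).aemeasurable (by fun_prop)]
    · exact iIndepFun_infinitePi (X := fun _ x => x ^ j) (fun i => by fun_prop)
  · exact integrable_coe_unitInterval (measurable_prodFirst.pow_const j)

theorem integral_distMap (d : ProbabilityMeasure ℕ∞) (ν : ProbabilityMeasure I) {f : I → ℝ}
    (hf : Continuous f) :
    ∫ x, f x ∂(distMap d ν : Measure I) = ∫ p, f (step p.1 p.2)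
      ∂((d : Measure ℕ∞).prod (Measure.infinitePi fun _ : ℕ => (ν : Measure I))) :=
  integral_map measurable_step.aemeasurable hf.aestronglyMeasurable

/-- Binomial expansion of $(1-\prod X_i)^k$; the $j$-th power of the product is the product of the
$X_i^j$, whose means are the $j$-th moment of $\nu$. -/
theorem coe_moment_distMap (d : ProbabilityMeasure ℕ∞) (ν : ProbabilityMeasure I) (k : ℕ) :
    (moment (distMap d ν) k : ℝ) = ∑ j ∈ Finset.range (k + 1), (-1) ^ j * (k.choose j : ℝ) *
      ∫ n, (prodFirst n (fun _ => moment ν j) : ℝ) ∂(d : Measure ℕ∞) := by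
  rw [coe_moment, integral_distMap d ν (by fun_prop)]
  have h : ∀ p : ℕ∞ × (ℕ → I), (step p.1 p.2 : ℝ) ^ k = ∑ j ∈ Finset.range (k + 1),
      (-1) ^ j * (k.choose j : ℝ) * (prodFirst p.1 p.2 : ℝ) ^ j := by
    intro p
    rw [step, unitInterval.coe_symm_eq, sub_eq_neg_add, add_pow]
    refine Finset.sum_congr rfl fun j _ => ?_
    rw [neg_pow]; ring
  simp_rw [h]
  rw [integral_finsetSum]
  · simp_rw [integral_const_mul, integral_prodFirst_pow]
  · intro j _
    exact (integrable_coe_unitInterval (measurable_prodFirst.pow_const j)).const_mul _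

theorem moment_zero (ν : ProbabilityMeasure I) : moment ν 0 = 1 := by
  rw [← Subtype.coe_inj, coe_moment]; simp

theorem moment_one_distMap (d : ProbabilityMeasure ℕ∞) {ν : ProbabilityMeasure I}
    (h : (moment ν 1 : ℝ) < 1) : (moment (distMap d ν) 1 : ℝ) = 1 - pgf d (moment ν 1) := by
  rw [coe_moment_distMap, Finset.sum_range_succ, Finset.sum_range_one, integral_prodFirst_const d h]
  have : ∀ n : ℕ∞, prodFirst n (fun _ => 1) = 1 := fun n => by simp [prodFirst]
  simp [moment_zero, this]
  ring

theorem moment_one_distMap_of_eq_one (d : ProbabilityMeasure ℕ∞) {ν : ProbabilityMeasure I}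
    (h : moment ν 1 = 1) : (moment (distMap d ν) 1 : ℝ) = 0 := by
  have : ∀ n : ℕ∞, prodFirst n (fun _ => 1) = 1 := fun n => by simp [prodFirst]
  rw [coe_moment_distMap, Finset.sum_range_succ, Finset.sum_range_one, h, moment_zero]
  simp [this]

theorem coe_moment_distMap_of_lt_one (d : ProbabilityMeasure ℕ∞) {ν : ProbabilityMeasure I}
    (h : (moment ν 1 : ℝ) < 1) (k : ℕ) :
    (moment (distMap d ν) k : ℝ) = (∑ j ∈ Finset.range k, (-1) ^ (j + 1) *
      (k.choose (j + 1) : ℝ) * pgf d (moment ν (j + 1))) + 1 := by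
  have h1 : ∀ n : ℕ∞, prodFirst n (fun _ => 1) = 1 := fun n => by simp [prodFirst]
  rw [coe_moment_distMap, Finset.sum_range_succ']
  congr 1
  · refine Finset.sum_congr rfl fun j _ => ?_
    rw [integral_prodFirst_const]
    exact lt_of_le_of_lt (moment_anti ν (by omega)) h
  · simp [moment_zero, h1]

theorem moment_two_distMap (d : ProbabilityMeasure ℕ∞) {ν : ProbabilityMeasure I}
    (h : (moment ν 1 : ℝ) < 1) :
    (moment (distMap d ν) 2 : ℝ) = 1 - 2 * pgf d (moment ν 1) + pgf d (moment ν 2) := by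
  rw [coe_moment_distMap_of_lt_one d h]
  simp [Finset.sum_range_succ]
  ring

/-- The independence hypotheses say that the joint law of $K$ and the sequence $Y$ is the product
measure in `distMap`. -/
theorem map_step_eq_distMap {Ω : Type*} [MeasurableSpace Ω] {P : Measure Ω}
    [IsProbabilityMeasure P] {d : ProbabilityMeasure ℕ∞} {ν : ProbabilityMeasure I}
    {K : Ω → ℕ∞} {Y : ℕ → Ω → I} (hK : Measurable K) (hY : ∀ i, Measurable (Y i))
    (hKlaw : P.map K = (d : Measure ℕ∞)) (hYlaw : ∀ i, P.map (Y i) = (ν : Measure I))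
    (hYind : iIndepFun Y P) (hKY : IndepFun K (fun ω i => Y i ω) P) :
    P.map (fun ω => step (K ω) (fun i => Y i ω)) = (distMap d ν : Measure I) := by
  have hY' : Measurable (fun ω i => Y i ω) := measurable_pi_lambda _ hY
  have h1 := (indepFun_iff_map_prod_eq_prod_map_map hK.aemeasurable hY'.aemeasurable).1 hKY
  rw [hKlaw, hYind.map_fun_eq_infinitePi_map hY] at h1
  simp_rw [hYlaw] at h1
  change _ = Measure.map _ _
  rw [← h1, Measure.map_map measurable_step (hK.prodMk hY')]
  rfl

end Moments

/-! ### Weak convergence on `[0,1]` and moments -/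

section WeakConvergence

theorem tendsto_moment {ι : Type*} {l : Filter ι} {νs : ι → ProbabilityMeasure I}
    {ν : ProbabilityMeasure I} (h : Tendsto νs l (𝓝 ν)) (k : ℕ) :
    Tendsto (fun n => (moment (νs n) k : ℝ)) l (𝓝 (moment ν k)) := by
  have := ProbabilityMeasure.tendsto_iff_forall_integral_tendsto.1 h
    (BoundedContinuousFunction.mkOfCompact ⟨fun x : I => (x : ℝ) ^ k, by fun_prop⟩)
  simpa [coe_moment] using this

theorem integral_polynomial_eq (ν : ProbabilityMeasure I) (p : Polynomial ℝ) :
    ∫ x, p.eval (x : ℝ) ∂(ν : Measure I) =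
      ∑ k ∈ Finset.range (p.natDegree + 1), p.coeff k * (moment ν k : ℝ) := by
  simp_rw [Polynomial.eval_eq_sum_range]
  rw [integral_finsetSum _ fun k _ => (integrable_pow ν k).const_mul _]
  simp_rw [integral_const_mul, coe_moment]

/-- Weierstrass approximation: integrals of polynomials are finite combinations of moments, and a
uniform error carries over to every probability measure. -/
theorem tendsto_of_tendsto_moment {ι : Type*} {l : Filter ι} {νs : ι → ProbabilityMeasure I}
    {ν : ProbabilityMeasure I}
    (h : ∀ k, Tendsto (fun n => (moment (νs n) k : ℝ)) l (𝓝 (moment ν k))) :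
    Tendsto νs l (𝓝 ν) := by
  refine ProbabilityMeasure.tendsto_iff_forall_integral_tendsto.2 fun f => ?_
  rw [Metric.tendsto_nhds]
  intro ε hε
  obtain ⟨p, hp⟩ := exists_polynomial_near_continuousMap 0 1 f.toContinuousMap (ε / 3)
    (by linarith)
  have hpt : ∀ x : I, |p.eval (x : ℝ) - f x| ≤ ε / 3 := fun x =>
    ((p.toContinuousMapOn (Set.Icc 0 1) - f.toContinuousMap).norm_coe_le_norm x).trans hp.le
  have hpint : ∀ ν' : ProbabilityMeasure I,
      Integrable (fun x : I => p.eval (x : ℝ)) (ν' : Measure I) := fun ν' =>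
    ((BoundedContinuousFunction.mkOfCompact (p.toContinuousMapOn (Set.Icc 0 1))).integrable _)
  have hclose : ∀ ν' : ProbabilityMeasure I,
      |∫ x, p.eval (x : ℝ) ∂(ν' : Measure I) - ∫ x, f x ∂(ν' : Measure I)| ≤ ε / 3 := by
    intro ν'
    rw [← integral_sub (hpint ν') (f.integrable _)]
    have := norm_integral_le_of_norm_le_const (μ := (ν' : Measure I))
      (f := fun x : I => p.eval (x : ℝ) - f x) (ae_of_all _ hpt)
    simpa using this
  have hlim : Tendsto (fun n => ∫ x, p.eval (x : ℝ) ∂(νs n : Measure I)) l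
      (𝓝 (∫ x, p.eval (x : ℝ) ∂(ν : Measure I))) := by
    simp_rw [integral_polynomial_eq]
    exact tendsto_finsetSum _ fun k _ => (h k).const_mul _
  filter_upwards [Metric.tendsto_nhds.1 hlim (ε / 3) (by linarith)] with n hn
  rw [Real.dist_eq] at hn ⊢
  have h1 := abs_le.1 (hclose (νs n))
  have h2 := abs_le.1 (hclose ν)
  have h3 := abs_lt.1 hn
  rw [abs_lt]
  constructor <;> linarith [h1.1, h1.2, h2.1, h2.2, h3.1, h3.2]

theorem eq_of_moment_eq {ν ν' : ProbabilityMeasure I} (h : ∀ k, moment ν k = moment ν' k) :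
    ν = ν' := by
  have : Tendsto (fun _ : ℕ => ν) atTop (𝓝 ν') :=
    tendsto_of_tendsto_moment fun k => by rw [h]; exact tendsto_const_nhds
  exact tendsto_nhds_unique tendsto_const_nhds this

theorem moment_twoPoint (m : I) {k : ℕ} (hk : k ≠ 0) : moment (twoPoint m) k = m := by
  rw [← Subtype.coe_inj, coe_moment]
  change ∫ x : I, (x : ℝ) ^ k ∂(ENNReal.ofReal (m : ℝ) • Measure.dirac 1 +
    ENNReal.ofReal (1 - (m : ℝ)) • Measure.dirac 0) = m
  have hint : ∀ a : I, Integrable (fun x : I => (x : ℝ) ^ k) (Measure.dirac a) := fun a => by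
    simpa using integrable_coe_unitInterval (P := Measure.dirac a) (Y := fun x => x ^ k)
      (by fun_prop)
  rw [integral_add_measure ((hint _).smul_measure ENNReal.ofReal_ne_top)
    ((hint _).smul_measure ENNReal.ofReal_ne_top), integral_smul_measure, integral_smul_measure,
    integral_dirac, integral_dirac]
  simp [hk, m.2.1]

/-- Pointwise, $x^{k+1}-x^{k+2}=x^k\cdot x(1-x)\le x(1-x)$. Hence equal first and second moments
force all later moments to agree. -/
theorem moment_sub_moment_succ_le (ν : ProbabilityMeasure I) (k : ℕ) :
    (moment ν (k + 1) : ℝ) - moment ν (k + 2) ≤ (moment ν 1 : ℝ) - moment ν 2 := by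
  simp only [coe_moment]
  rw [← integral_sub (integrable_pow ν _) (integrable_pow ν _),
    ← integral_sub (integrable_pow ν _) (integrable_pow ν _)]
  refine integral_mono ((integrable_pow ν _).sub (integrable_pow ν _))
    ((integrable_pow ν _).sub (integrable_pow ν _)) fun x => ?_
  have h1 : (x : ℝ) ^ k ≤ 1 := pow_le_one₀ x.2.1 x.2.2
  have h2 : 0 ≤ (x : ℝ) * (1 - x) := mul_nonneg x.2.1 (by linarith [x.2.2])
  have := mul_le_mul_of_nonneg_right h1 h2
  simp only
  ring_nf at this ⊢
  linarith

theorem eq_twoPoint_of_moment {ν : ProbabilityMeasure I} {m : I} (h1 : moment ν 1 = m)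
    (h2 : moment ν 2 = m) : ν = twoPoint m := by
  have hk : ∀ k, moment ν (k + 1) = m := by
    intro k
    induction k with
    | zero => exact h1
    | succ k ih =>
      refine le_antisymm (h1 ▸ moment_anti ν (by omega)) ?_
      have := moment_sub_moment_succ_le ν k
      rw [ih, h1, h2] at this
      rw [← Subtype.coe_le_coe]
      linarith
  refine eq_of_moment_eq fun k => ?_
  rcases k with _ | k
  · rw [moment_zero, moment_zero]
  · rw [hk, moment_twoPoint m k.succ_ne_zero]

theorem moment_two_lt_of_ne_twoPoint {ν : ProbabilityMeasure I} {m : I} (h1 : moment ν 1 = m)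
    (h : ν ≠ twoPoint m) : moment ν 2 < m :=
  lt_of_le_of_ne (h1 ▸ moment_anti ν one_le_two) fun h2 => h (eq_twoPoint_of_moment h1 h2)

end WeakConvergence

/-! ### Invariant laws and their basins -/

section Basin

variable {d : ProbabilityMeasure ℕ∞} {m : I}

theorem moment_one_of_distMap_eq {ν : ProbabilityMeasure I} (h : distMap d ν = ν) :
    (moment ν 1 : ℝ) < 1 ∧ (moment ν 1 : ℝ) = 1 - pgf d (moment ν 1) := by
  have hlt : (moment ν 1 : ℝ) < 1 := by
    refine lt_of_le_of_ne (moment ν 1).2.2 fun h1 => ?_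
    have h0 := moment_one_distMap_of_eq_one d (ν := ν) (Subtype.ext h1)
    rw [h, h1] at h0
    exact one_ne_zero h0
  exact ⟨hlt, by conv_lhs => rw [← h, moment_one_distMap d hlt]⟩

theorem mean_twoPoint_fixed (h : distMap d (twoPoint m) = twoPoint m) :
    (m : ℝ) < 1 ∧ (m : ℝ) = 1 - pgf d m := by
  simpa [moment_twoPoint m one_ne_zero] using moment_one_of_distMap_eq h

theorem moment_one_eq_of_distMap_eq (hconv : StrictConvexOn ℝ (Set.Icc 0 1) (pgf d))
    (hm : (m : ℝ) = 1 - pgf d m) {ν : ProbabilityMeasure I} (h : distMap d ν = ν) :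
    moment ν 1 = m := by
  have hmono := strictMonoOn_of_monotoneOn_of_strictConvexOn (pgf_monotoneOn d) hconv
  have h1 := (moment_one_of_distMap_eq h).2
  rcases lt_trichotomy (moment ν 1 : ℝ) (m : ℝ) with hlt | heq | hlt
  · linarith [hmono (moment ν 1).2 m.2 hlt]
  · exact Subtype.ext heq
  · linarith [hmono m.2 (moment ν 1).2 hlt]

/-- The mean can be traced backwards because $H$ is injective on $[0,1]$. Mean $1$ is sent to mean
$0$, which is not $m$ since $1-H(0)=1$. -/
theorem moment_one_eq_of_distMap (hH0 : pgf d 0 = 0)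
    (hconv : StrictConvexOn ℝ (Set.Icc 0 1) (pgf d))
    (hm : (m : ℝ) = 1 - pgf d m) {ν : ProbabilityMeasure I} (h : moment (distMap d ν) 1 = m) :
    moment ν 1 = m := by
  have hmono := strictMonoOn_of_monotoneOn_of_strictConvexOn (pgf_monotoneOn d) hconv
  rcases (moment ν 1).2.2.lt_or_eq with hlt | heq
  · refine Subtype.ext (hmono.injOn (moment ν 1).2 m.2 ?_)
    have := moment_one_distMap d hlt
    rw [h] at this
    linarith
  · have h0 := moment_one_distMap_of_eq_one d (ν := ν) (Subtype.ext heq)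
    rw [h] at h0
    rw [h0, hH0] at hm
    norm_num at hm

theorem moment_one_eq_of_iterate (hH0 : pgf d 0 = 0)
    (hconv : StrictConvexOn ℝ (Set.Icc 0 1) (pgf d))
    (hm : (m : ℝ) = 1 - pgf d m) {ν : ProbabilityMeasure I} (n : ℕ)
    (h : moment ((distMap d)^[n] ν) 1 = m) : moment ν 1 = m := by
  induction n generalizing ν with
  | zero => exact h
  | succ n ih => exact moment_one_eq_of_distMap hH0 hconv hm (ih h)

theorem moment_one_iterate (hm1 : (m : ℝ) < 1) (hm : (m : ℝ) = 1 - pgf d m)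
    {ν : ProbabilityMeasure I} (h : moment ν 1 = m) (n : ℕ) :
    moment ((distMap d)^[n] ν) 1 = m := by
  induction n with
  | zero => exact h
  | succ n ih =>
    rw [Function.iterate_succ_apply']
    refine Subtype.ext ?_
    rw [moment_one_distMap d (by rw [ih]; exact hm1), ih, ← hm]

theorem moment_two_distMap_of_mean (hm1 : (m : ℝ) < 1) (hm : (m : ℝ) = 1 - pgf d m)
    {ν : ProbabilityMeasure I} (h : moment ν 1 = m) :
    (moment (distMap d ν) 2 : ℝ) = (2 * m - 1) + pgf d (moment ν 2) := by
  rw [moment_two_distMap d (by rw [h]; exact hm1), h]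
  linarith

/-- The $k$-th moment is driven by lower moments, already convergent, plus $\pm H$ of itself. This
is a contraction with vanishing error once the second moment has fallen below $b$. -/
theorem tendsto_iterate_of_mean (hconv : StrictConvexOn ℝ (Set.Icc 0 1) (pgf d))
    (hm1 : (m : ℝ) < 1) (hm : (m : ℝ) = 1 - pgf d m) {ς ν : ProbabilityMeasure I}
    (hς : distMap d ς = ς) (hςne : ς ≠ twoPoint m) (hν : moment ν 1 = m)
    (hνne : ν ≠ twoPoint m) : Tendsto (fun n => (distMap d)^[n] ν) atTop (𝓝 ς) := by
  have hς1 : moment ς 1 = m := moment_one_eq_of_distMap_eq hconv hm hς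
  have hς2 : (moment ς 2 : ℝ) < m := moment_two_lt_of_ne_twoPoint hς1 hςne
  have hmean := moment_one_iterate hm1 hm hν
  obtain ⟨b, ρ, hsb, hbm, hρ0, hρ1, hlip, habs⟩ := exists_contraction_below (c := 2 * (m : ℝ) - 1)
    (pgf_monotoneOn d) hconv (pgf_continuousOn d) (moment ς 2).2.1 hς2 hm1.le
    (by rw [← moment_two_distMap_of_mean hm1 hm hς1, hς]) (by linarith)
  have hev : ∀ᶠ n in atTop, (moment ((distMap d)^[n] ν) 2 : ℝ) ≤ b :=
    habs (fun n => (moment ((distMap d)^[n] ν) 2 : ℝ)) (fun n => unitInterval.nonneg _)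
      (moment_two_lt_of_ne_twoPoint hν hνne) fun n => by
        rw [Function.iterate_succ_apply', moment_two_distMap_of_mean hm1 hm (hmean n)]
  refine tendsto_of_tendsto_moment fun k => ?_
  induction k using Nat.strong_induction_on with
  | _ k ih =>
  rcases k with _ | _ | k
  · simp [moment_zero]
  · simp [hmean, hς1]
  set a : ℕ → ℝ := fun n => (moment ((distMap d)^[n] ν) (k + 2) : ℝ) with ha
  set A : ℝ := (moment ς (k + 2) : ℝ) with hA
  set S : ProbabilityMeasure I → ℝ := fun ν' => (∑ j ∈ Finset.range (k + 1), (-1) ^ (j + 1) *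
      ((k + 2).choose (j + 1) : ℝ) * pgf d (moment ν' (j + 1))) + 1 with hS
  have hexp : ∀ ν' : ProbabilityMeasure I, moment ν' 1 = m →
      (moment (distMap d ν') (k + 2) : ℝ) =
        S ν' + (-1) ^ (k + 2) * pgf d (moment ν' (k + 2)) := by
    intro ν' hν'
    rw [coe_moment_distMap_of_lt_one d (by rw [hν']; exact hm1), Finset.sum_range_succ]
    simp only [hS, Nat.choose_self]
    push_cast
    ring
  have hSlim : Tendsto (fun n => S ((distMap d)^[n] ν)) atTop (𝓝 (S ς)) := by
    refine (tendsto_finsetSum _ fun j hj => ?_).add_const _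
    refine Tendsto.const_mul _ ?_
    have hc := pgf_continuousOn d (moment ς (j + 1)) (moment ς (j + 1)).2
    refine hc.tendsto.comp (tendsto_nhdsWithin_iff.2 ⟨?_, Eventually.of_forall fun n =>
      (moment ((distMap d)^[n] ν) (j + 1)).2⟩)
    exact ih (j + 1) (by have := Finset.mem_range.1 hj; omega)
  have hd : Tendsto (fun n => |a n - A|) atTop (𝓝 0) := by
    refine tendsto_zero_of_le_mul_add (e := fun n => |S ((distMap d)^[n] ν) - S ς|) hρ0 hρ1
      (fun n => abs_nonneg _) ?_ ?_
    · simpa using (hSlim.sub_const (S ς)).abs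
    · filter_upwards [hev] with n hn
      have h1 : a (n + 1) - A = (S ((distMap d)^[n] ν) - S ς) +
          (-1) ^ (k + 2) * (pgf d (a n) - pgf d A) := by
        have e1 := hexp _ (hmean n)
        have e2 := hexp _ hς1
        rw [hς] at e2
        simp only [ha, hA, Function.iterate_succ_apply']
        rw [e1]
        linear_combination -e2
      rw [h1, add_comm (ρ * _)]
      refine (abs_add_le _ _).trans (add_le_add_right ?_ _)
      -- The alternating sign disappears in absolute value, so odd and even orders contract alike.
      rw [abs_mul, abs_pow, abs_neg, abs_one, one_pow, one_mul]
      refine hlip _ ⟨unitInterval.nonneg _, le_trans ?_ hn⟩ _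
        ⟨unitInterval.nonneg _, le_trans ?_ hsb⟩
      · exact moment_anti _ (by omega)
      · exact moment_anti _ (by omega)
  exact tendsto_iff_dist_tendsto_zero.2 (by simpa only [Real.dist_eq] using hd)

theorem basin_eq_of_distMap_eq (hH0 : pgf d 0 = 0)
    (hconv : StrictConvexOn ℝ (Set.Icc 0 1) (pgf d)) (hfix : distMap d (twoPoint m) = twoPoint m)
    (hunst : 1 < deriv (pgf d) (m : ℝ)) {ς : ProbabilityMeasure I}
    (hς : distMap d ς = ς) (hςne : ς ≠ twoPoint m) :
    basin d ς = {ν | moment ν 1 = m ∧ ν ≠ twoPoint m} := by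
  obtain ⟨hm1, hm⟩ := mean_twoPoint_fixed hfix
  ext ν
  refine ⟨fun h => ⟨?_, ?_⟩, fun h => tendsto_iterate_of_mean hconv hm1 hm hς hςne h.1 h.2⟩
  · have hlim : Tendsto (fun n => (moment ((distMap d)^[n] ν) 1 : ℝ)) atTop (𝓝 (m : ℝ)) := by
      have := tendsto_moment h 1
      rwa [moment_one_eq_of_distMap_eq hconv hm hς] at this
    obtain ⟨c, hc, hexp⟩ := exists_expanding_of_one_lt_deriv hunst
    have hev := eventually_eq_of_tendsto_of_expanding hc hexp hlim (by
      -- The formula for the mean needs a mean below $1$, which holds eventually because $m<1$.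
      filter_upwards [hlim.eventually (gt_mem_nhds hm1)] with n hn
      rw [Function.iterate_succ_apply', moment_one_distMap d hn, ← abs_neg]
      congr 1
      linarith)
    obtain ⟨n, hn⟩ := hev.exists
    exact moment_one_eq_of_iterate hH0 hconv hm n (Subtype.ext hn)
  · rintro rfl
    have hconst : ∀ n, (distMap d)^[n] (twoPoint m) = twoPoint m := fun n =>
      Function.iterate_fixed hfix n
    have h' : Tendsto (fun n => (distMap d)^[n] (twoPoint m)) atTop (𝓝 ς) := h
    simp_rw [hconst] at h'
    exact hςne (tendsto_nhds_unique h' tendsto_const_nhds)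

/-- In the unstable case the second moments of the iterates of the point mass at the mean stay away
from the mean. -/
theorem exists_moment_two_iterate_le (hm0 : 0 < (m : ℝ)) (hm1 : (m : ℝ) < 1)
    (hm : (m : ℝ) = 1 - pgf d m) (hunst : 1 < deriv (pgf d) (m : ℝ)) :
    ∃ b < (m : ℝ), ∀ ν : ProbabilityMeasure I, moment ν 1 = m → (moment ν 2 : ℝ) = (m : ℝ) ^ 2 →
      ∀ n, (moment ((distMap d)^[n] ν) 2 : ℝ) ≤ b := by
  obtain ⟨c, hc, hexp⟩ := exists_expanding_of_one_lt_deriv hunst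
  have hsq : (m : ℝ) ^ 2 < m := by nlinarith
  -- For $b<m$ close to $m$, expansion gives $2m-1+H(b)\le m-c(m-b)\le b$, so $[0,b]$ is invariant;
  -- $b>m^2$ puts the starting second moment inside.
  obtain ⟨b, hb, hbm⟩ := (((hexp.filter_mono nhdsWithin_le_nhds).and
    (Ioo_mem_nhdsLT hsq)) : ∀ᶠ x in 𝓝[<] (m : ℝ), _).exists
  have hbI : b ∈ Set.Icc (0 : ℝ) 1 := ⟨by nlinarith [hbm.1], by linarith [hbm.2]⟩
  have hmI : (m : ℝ) ∈ Set.Icc (0 : ℝ) 1 := m.2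
  rw [abs_sub_comm, abs_of_pos (sub_pos.2 hbm.2), abs_sub_comm,
    abs_of_nonneg (sub_nonneg.2 (pgf_monotoneOn d hbI hmI hbm.2.le))] at hb
  refine ⟨b, hbm.2, fun ν hν1 hν2 n => ?_⟩
  induction n with
  | zero => rw [Function.iterate_zero_apply, hν2]; exact hbm.1.le
  | succ n ih =>
    rw [Function.iterate_succ_apply', moment_two_distMap_of_mean hm1 hm
      (moment_one_iterate hm1 hm hν1 n)]
    have h1 := pgf_monotoneOn d (moment ((distMap d)^[n] ν) 2).2 hbI ih
    nlinarith [hbm.2]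

end Basin

/-! ### Independence of functions of disjoint blocks -/

section Blocks

variable {Ω ι κ β γ γ' : Type*} [MeasurableSpace β]

/-- The `σ`-algebra generated by the variables `X i` with `i ∈ S`. -/
abbrev blockSigma (X : ι → Ω → β) (S : Set ι) : MeasurableSpace Ω :=
  ⨆ i ∈ S, MeasurableSpace.comap (X i) inferInstance

theorem blockSigma_mono (X : ι → Ω → β) {S T : Set ι} (h : S ⊆ T) :
    blockSigma X S ≤ blockSigma X T :=
  biSup_mono h

theorem measurable_blockSigma (X : ι → Ω → β) {S : Set ι} {i : ι} (hi : i ∈ S) :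
    Measurable[blockSigma X S] (X i) :=
  (comap_measurable (X i)).mono
    (le_iSup₂_of_le (f := fun i (_ : i ∈ S) => MeasurableSpace.comap (X i) inferInstance)
      i hi le_rfl) le_rfl

theorem blockSigma_eq_comap (X : ι → Ω → β) (p : ι → Prop) :
    blockSigma X {i | p i} =
      MeasurableSpace.comap (fun ω (i : {i // p i}) => X i ω) inferInstance := by
  rw [blockSigma, MeasurableSpace.pi, MeasurableSpace.comap_iSup, iSup_subtype']
  simp_rw [MeasurableSpace.comap_comp]
  rfl

variable [MeasurableSpace Ω] [MeasurableSpace γ] [MeasurableSpace γ'] {P : Measure Ω}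

theorem blockSigma_le {X : ι → Ω → β} (hX : ∀ i, Measurable (X i)) (S : Set ι) :
    blockSigma X S ≤ (inferInstance : MeasurableSpace Ω) :=
  iSup₂_le fun i _ => (hX i).comap_le

theorem indep_blockSigma {X : ι → Ω → β} (hX : ∀ i, Measurable (X i)) (h : iIndepFun X P)
    {S T : Set ι} (hST : Disjoint S T) : Indep (blockSigma X S) (blockSigma X T) P :=
  indep_iSup_of_disjoint (fun i => (hX i).comap_le) ((iIndepFun_iff_iIndep _ _ _).1 h) hST

theorem indepFun_of_blocks {X : ι → Ω → β} (hX : ∀ i, Measurable (X i)) (h : iIndepFun X P)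
    {S T : Set ι} (hST : Disjoint S T) {Y : Ω → γ} {Z : Ω → γ'}
    (hY : Measurable[blockSigma X S] Y) (hZ : Measurable[blockSigma X T] Z) : IndepFun Y Z P := by
  rw [IndepFun_iff_Indep]
  exact indep_of_indep_of_le_left (indep_of_indep_of_le_right (indep_blockSigma hX h hST)
    hZ.comap_le) hY.comap_le

/-- Induction over finite subfamilies: a new block is disjoint from the union of the earlier ones,
so its $\sigma$-algebra is independent of theirs. -/
theorem iIndepFun_of_blocks [IsProbabilityMeasure P] {X : ι → Ω → β} (hX : ∀ i, Measurable (X i))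
    (h : iIndepFun X P) {S : κ → Set ι} (hS : Pairwise (Function.onFun Disjoint S))
    {Y : κ → Ω → γ} (hY : ∀ k, Measurable[blockSigma X (S k)] (Y k)) : iIndepFun Y P := by
  classical
  rw [iIndepFun_iff_measure_inter_preimage_eq_mul]
  intro F
  induction F using Finset.induction_on with
  | empty => intro sets _; simp
  | insert a F ha ih =>
    intro sets hsets
    rw [Finset.prod_insert ha, ← ih fun i hi => hsets i (Finset.mem_insert_of_mem hi),
      Finset.set_biInter_insert]
    have hdisj : Disjoint (S a) (⋃ k ∈ F, S k) := by
      rw [Set.disjoint_iUnion₂_right]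
      intro k hk
      exact hS fun hak => ha (hak ▸ hk)
    refine (Indep_iff _ _ _).1 (indep_blockSigma hX h hdisj) _ _
      (hY a (hsets a (Finset.mem_insert_self _ _))) ?_
    refine MeasurableSet.biInter (m := blockSigma X (⋃ k ∈ F, S k)) F.countable_toSet fun k hk => ?_
    exact blockSigma_mono X (Set.subset_biUnion_of_mem (u := S) hk) _
      (hY k (hsets k (Finset.mem_insert_of_mem hk)))

end Blocks

/-! ### Iterating the recursion on the tree -/

section Iter

/-- The value at the node `u` when the recursion is run from the values `x` given `m` levels below
`u`. -/
noncomputable def iter (N : List ℕ → ℕ∞) (x : List ℕ → I) : ℕ → List ℕ → I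
  | 0, u => x u
  | m + 1, u => step (N u) fun i => iter N x m (u ++ [i])

variable {N N' : List ℕ → ℕ∞} {x x' : List ℕ → I}

theorem iter_congr (m : ℕ) (u : List ℕ) (hN : ∀ v : List ℕ, v.length < u.length + m → N v = N' v)
    (hx : ∀ v : List ℕ, v.length = u.length + m → x v = x' v) : iter N x m u = iter N' x' m u := by
  induction m generalizing u with
  | zero => exact hx u rfl
  | succ m ih =>
    simp only [iter]
    rw [hN u (by omega)]
    congr 1
    funext i
    refine ih _ (fun v hv => hN v ?_) (fun v hv => hx v ?_) <;>
      · rw [List.length_append, List.length_singleton] at hv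
        omega

/-- `iter` unfolds at the top; peeling at the bottom instead compares consecutive depths, as the
martingale property requires. -/
theorem iter_succ_eq (N : List ℕ → ℕ∞) (x : List ℕ → I) (m : ℕ) (u : List ℕ) :
    iter N x (m + 1) u = iter N (fun v => step (N v) fun i => x (v ++ [i])) m u := by
  induction m generalizing u with
  | zero => rfl
  | succ m ih =>
    rw [iter, iter]
    simp_rw [ih]

theorem iter_append (N : List ℕ → ℕ∞) (x : List ℕ → I) (m : ℕ) (u v : List ℕ) :
    iter N x m (u ++ v) = iter (fun w => N (u ++ w)) (fun w => x (u ++ w)) m v := by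
  induction m generalizing v with
  | zero => rfl
  | succ m ih => simp only [iter, List.append_assoc, ih]

theorem iter_eq_self (h : ∀ u, x u = step (N u) fun i => x (u ++ [i])) (m : ℕ) (u : List ℕ) :
    iter N x m u = x u := by
  induction m generalizing u with
  | zero => rfl
  | succ m ih => rw [iter, h u]; simp_rw [ih]

theorem measurable_iter {Ω : Type*} (𝓜 : MeasurableSpace Ω) {N : List ℕ → Ω → ℕ∞}
    {x : List ℕ → Ω → I} (m : ℕ) (u : List ℕ)
    (hN : ∀ v : List ℕ, u <+: v → v.length < u.length + m → Measurable[𝓜] (N v))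
    (hx : ∀ v : List ℕ, u <+: v → v.length = u.length + m → Measurable[𝓜] (x v)) :
    Measurable[𝓜] (fun ω => iter (fun v => N v ω) (fun v => x v ω) m u) := by
  induction m generalizing u with
  | zero => exact hx u List.prefix_rfl rfl
  | succ m ih =>
    refine measurable_step.comp (Measurable.prodMk (hN u List.prefix_rfl (by omega))
      (measurable_pi_lambda _ fun i => ih _ (fun v huv hv => hN v ?_ ?_)
        (fun v huv hv => hx v ?_ ?_)))
    all_goals first
      | exact (List.prefix_append u [i]).trans huv
      | (rw [List.length_append, List.length_singleton] at hv; omega)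

theorem disjoint_prefix {u v : List ℕ} (hl : u.length = v.length) (h : u ≠ v) :
    Disjoint {w : List ℕ | u <+: w} {w | v <+: w} := by
  rw [Set.disjoint_left]
  intro w hu hv
  exact h ((List.prefix_of_prefix_length_le hu hv hl.le).eq_of_length hl)

theorem pairwise_disjoint_prefix_daughters (u : List ℕ) :
    Pairwise (Function.onFun Disjoint fun i : ℕ => {w : List ℕ | u ++ [i] <+: w}) := by
  intro i j hij
  refine disjoint_prefix (by simp) fun h => hij ?_
  simpa using h

end Iter

/-! ### Conditional expectations given the first levels -/

section TreeExpectation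

variable {Ω : Type*} [MeasurableSpace Ω] {P : Measure Ω} [IsProbabilityMeasure P] {m : I}

theorem expect_symm {Y : Ω → I} (hY : Measurable Y) :
    expect P (fun ω => σ (Y ω)) = σ (expect P Y) := by
  refine Subtype.ext ?_
  simp only [expect, unitInterval.coe_symm_eq]
  rw [integral_sub (integrable_const _) (integrable_coe_unitInterval hY)]
  simp

/-- For a deterministic tree, the recursion commutes with taking means of independent values. -/
theorem expect_iter {Z : List ℕ → Ω → I} (hZ : ∀ v, Measurable (Z v)) {n : ℕ}
    (hind : iIndepFun (fun v : {v : List ℕ // v.length = n} => Z v) P)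
    (hmean : ∀ v : List ℕ, v.length = n → expect P (Z v) = m) (N : List ℕ → ℕ∞) (j : ℕ)
    (u : List ℕ) (hu : u.length + j = n) :
    expect P (fun ω => iter N (fun v => Z v ω) j u) = iter N (fun _ => m) j u := by
  induction j generalizing u with
  | zero => exact hmean u hu
  | succ j ih =>
    have hlen : ∀ i : ℕ, (u ++ [i]).length + j = n := fun i => by
      rw [List.length_append, List.length_singleton]; omega
    have hm : ∀ i : ℕ, Measurable fun ω => iter N (fun v => Z v ω) j (u ++ [i]) := fun i =>
      measurable_iter _ (N := fun v _ => N v) j _ (fun v _ _ => measurable_const)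
        (fun v _ _ => hZ v)
    have hindY : iIndepFun (fun (i : ℕ) ω => iter N (fun v => Z v ω) j (u ++ [i])) P := by
      refine iIndepFun_of_blocks (X := fun v : {v : List ℕ // v.length = n} => Z v)
        (fun v => hZ v) hind
        (S := fun i => {w : {v : List ℕ // v.length = n} | u ++ [i] <+: w.1}) ?_ fun i => ?_
      · intro i j hij
        exact (pairwise_disjoint_prefix_daughters u hij).preimage Subtype.val
      · refine measurable_iter _ (N := fun v _ => N v) j _ (fun v _ _ => measurable_const)
          fun v hv hl => ?_
        exact measurable_blockSigma (fun v : {v : List ℕ // v.length = n} => Z v)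
          (i := ⟨v, hl.trans (hlen i)⟩) hv
    simp only [iter, step]
    rw [expect_symm (Y := fun ω => prodFirst (N u) fun i => iter N (fun v => Z v ω) j (u ++ [i]))
      ((measurable_prodFirst_apply _).comp (measurable_pi_lambda _ hm))]
    congr 1
    refine Subtype.ext ((integral_prodFirst hm hindY (N u)).trans ?_)
    simp_rw [fun i => ih (u ++ [i]) (hlen i)]

/-- By independence and Fubini the family sizes above level $n$ can be frozen; on the frozen tree
`expect_iter` replaces the values at level $n$ by their means. -/
theorem condExp_iter {Z : List ℕ → Ω → I} (hZ : ∀ v, Measurable (Z v)) {N : List ℕ → Ω → ℕ∞}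
    (hN : ∀ v, Measurable (N v)) (n : ℕ)
    (hind : iIndepFun (fun v : {v : List ℕ // v.length = n} => Z v) P)
    (hmean : ∀ v : List ℕ, v.length = n → expect P (Z v) = m)
    (hZN : IndepFun (fun ω (v : {v : List ℕ // v.length = n}) => Z v ω)
      (fun ω (v : {v : List ℕ // v.length < n}) => N v ω) P) :
    P[fun ω => (iter (fun v => N v ω) (fun v => Z v ω) n [] : ℝ) |
        blockSigma N {v | v.length < n}] =ᵐ[P]
      fun ω => (iter (fun v => N v ω) (fun _ => m) n [] : ℝ) := by
  set G : Ω → {v : List ℕ // v.length < n} → ℕ∞ := fun ω v => N v ω with hG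
  set F : Ω → {v : List ℕ // v.length = n} → I := fun ω v => Z v ω with hF
  have hGm : Measurable G := measurable_pi_lambda _ fun v => hN v
  have hFm : Measurable F := measurable_pi_lambda _ fun v => hZ v
  -- Both extensions take the default value $0$ off their levels, where the recursion from the root
  -- never reads them.
  set Ne : List ℕ → ({v : List ℕ // v.length < n} → ℕ∞) → ℕ∞ :=
    fun v η => if h : v.length < n then η ⟨v, h⟩ else 0 with hNe
  set Ze : List ℕ → ({v : List ℕ // v.length = n} → I) → I :=
    fun v ζ => if h : v.length = n then ζ ⟨v, h⟩ else 0 with hZe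
  have hNem : ∀ v, Measurable (Ne v) := fun v => by
    by_cases h : v.length < n <;> simp only [hNe, h, dite_true, dite_false] <;> fun_prop
  have hZem : ∀ v, Measurable (Ze v) := fun v => by
    by_cases h : v.length = n <;> simp only [hZe, h, dite_true, dite_false] <;> fun_prop
  set Φ : ({v : List ℕ // v.length < n} → ℕ∞) × ({v : List ℕ // v.length = n} → I) → ℝ :=
    fun p => iter (fun v => Ne v p.1) (fun v => Ze v p.2) n [] with hΦ
  have hΦI : Measurable fun p : ({v : List ℕ // v.length < n} → ℕ∞) ×
      ({v : List ℕ // v.length = n} → I) => iter (fun v => Ne v p.1) (fun v => Ze v p.2) n [] :=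
    measurable_iter (Ω := ({v : List ℕ // v.length < n} → ℕ∞) × ({v : List ℕ // v.length = n} → I))
      _ (N := fun v p => Ne v p.1) (x := fun v p => Ze v p.2) n []
      (fun v _ _ => (hNem v).comp measurable_fst) (fun v _ _ => (hZem v).comp measurable_snd)
  have hΨI : Measurable fun η : {v : List ℕ // v.length < n} → ℕ∞ =>
      iter (fun v => Ne v η) (fun _ => m) n [] :=
    measurable_iter _ (x := fun _ _ => m) n [] (fun v _ _ => hNem v) (fun _ _ _ => measurable_const)
  have hinner : ∀ η, ∫ ζ, Φ (η, ζ) ∂(P.map F) = iter (fun v => Ne v η) (fun _ => m) n [] := by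
    intro η
    rw [integral_map (f := fun ζ => Φ (η, ζ)) hFm.aemeasurable (measurable_subtype_coe.comp
        (hΦI.comp (measurable_const.prodMk measurable_id))).aestronglyMeasurable,
      ← expect_iter hZ hind hmean (fun v => Ne v η) n [] (by simp)]
    refine integral_congr_ae (ae_of_all _ fun ω => ?_)
    simp only [hΦ]
    congr 1
    refine iter_congr _ _ (fun _ _ => rfl) fun v hv => ?_
    have : v.length = n := by simpa using hv
    simp [hZe, hF, this]
  have hΦω : ∀ ω, (iter (fun v => N v ω) (fun v => Z v ω) n [] : ℝ) = Φ (G ω, F ω) := by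
    intro ω
    simp only [hΦ]
    congr 1
    refine iter_congr _ _ (fun v hv => ?_) fun v hv => ?_
    · have : v.length < n := by simpa using hv
      simp [hNe, hG, this]
    · have : v.length = n := by simpa using hv
      simp [hZe, hF, this]
  have hΨω : ∀ ω, (iter (fun v => N v ω) (fun _ => m) n [] : ℝ) =
      iter (fun v => Ne v (G ω)) (fun _ => m) n [] := by
    intro ω
    congr 1
    refine iter_congr _ _ (fun v hv => ?_) fun _ _ => rfl
    have : v.length < n := by simpa using hv
    simp [hNe, hG, this]
  have hMm : Measurable[blockSigma N {v | v.length < n}]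
      fun ω => iter (fun v => N v ω) (fun _ => m) n [] :=
    measurable_iter _ (x := fun _ _ => m) n []
      (fun v _ hv => measurable_blockSigma N (by simpa using hv)) (fun _ _ _ => measurable_const)
  refine (ae_eq_condExp_of_forall_setIntegral_eq (blockSigma_le hN _)
    (integrable_coe_unitInterval (measurable_iter _ n [] (fun v _ _ => hN v) fun v _ _ => hZ v))
    (fun s _ _ => (integrable_coe_unitInterval
      (hMm.mono (blockSigma_le hN _) le_rfl)).integrableOn) ?_
    (measurable_subtype_coe.comp hMm).stronglyMeasurable.aestronglyMeasurable).symm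
  intro s hs _
  rw [blockSigma_eq_comap] at hs
  obtain ⟨A, hA, rfl⟩ := hs
  change ∫ ω in G ⁻¹' A, _ ∂P = ∫ ω in G ⁻¹' A, _ ∂P
  simp_rw [hΦω, hΨω]
  have hpre : G ⁻¹' A = (fun ω => (G ω, F ω)) ⁻¹' (A ×ˢ Set.univ) := by ext; simp
  have hΦint : Integrable Φ ((P.map G).prod (P.map F)) := by
    have := Measure.isProbabilityMeasure_map (μ := P) hGm.aemeasurable
    have := Measure.isProbabilityMeasure_map (μ := P) hFm.aemeasurable
    exact integrable_coe_unitInterval hΦI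
  have hR : ∫ ω in G ⁻¹' A, Φ (G ω, F ω) ∂P =
      ∫ η in A, (iter (fun v => Ne v η) (fun _ => m) n [] : ℝ) ∂(P.map G) := by
    rw [hpre, ← setIntegral_map (g := fun ω => (G ω, F ω)) (f := Φ) (hA.prod MeasurableSet.univ)
      (measurable_subtype_coe.comp hΦI).aestronglyMeasurable (hGm.prodMk hFm).aemeasurable,
      (indepFun_iff_map_prod_eq_prod_map_map hGm.aemeasurable hFm.aemeasurable).1 hZN.symm,
      setIntegral_prod _ hΦint.integrableOn]
    simp_rw [setIntegral_univ, hinner]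
  rw [hR, setIntegral_map (g := G)
    (f := fun η => (iter (fun v => Ne v η) (fun _ => m) n [] : ℝ)) hA
    (measurable_subtype_coe.comp hΨI).aestronglyMeasurable
    hGm.aemeasurable]

end TreeExpectation

/-! ### Limits of moments and of infinite products -/

section Convergence

variable {Ω : Type*} [MeasurableSpace Ω] {P : Measure Ω}

theorem coe_moment_of_coe_eq_map {ν : ProbabilityMeasure I} {Y : Ω → I} (hY : Measurable Y)
    (h : (ν : Measure I) = P.map Y) (k : ℕ) :
    (moment ν k : ℝ) = ∫ ω, (Y ω : ℝ) ^ k ∂P := by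
  rw [coe_moment, h, integral_map hY.aemeasurable (by fun_prop)]

theorem tendsto_integral_pow [IsProbabilityMeasure P] {Y : ℕ → Ω → I} {Y' : Ω → I} (hY : ∀ n, Measurable (Y n))
    (h : ∀ᵐ ω ∂P, Tendsto (fun n => Y n ω) atTop (𝓝 (Y' ω))) (k : ℕ) :
    Tendsto (fun n => ∫ ω, (Y n ω : ℝ) ^ k ∂P) atTop (𝓝 (∫ ω, (Y' ω : ℝ) ^ k ∂P)) := by
  refine tendsto_integral_of_dominated_convergence (fun _ => 1) (fun n => ?_)
    (integrable_const 1) (fun n => ae_of_all _ fun ω => ?_) ?_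
  · have := hY n
    fun_prop
  · rw [norm_pow, Real.norm_of_nonneg (unitInterval.nonneg _)]
    exact pow_le_one₀ (unitInterval.nonneg _) (unitInterval.le_one _)
  · filter_upwards [h] with ω hω
    exact ((continuous_subtype_val.tendsto _).comp hω).pow k

/-- Infinite products are only upper semicontinuous, as finite truncations bound them from above.
This suffices when the limiting product is $0$. -/
theorem tendsto_prodFirst_of_tendsto {K : ℕ∞} {x : ℕ → ℕ → I} {y : ℕ → I}
    (hx : ∀ i, Tendsto (fun n => x n i) atTop (𝓝 (y i))) (hK : K = ⊤ → prodFirst K y = 0) :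
    Tendsto (fun n => prodFirst K (x n)) atTop (𝓝 (prodFirst K y)) := by
  induction K using ENat.recTopCoe with
  | coe K =>
    simp_rw [prodFirst_natCast]
    exact tendsto_finsetProd _ fun i _ => hx i
  | top =>
    have h0 := hK rfl
    rw [h0]
    refine tendsto_order.2 ⟨fun a ha => absurd ha (not_lt.2 unitInterval.nonneg'), fun a ha => ?_⟩
    have hlim := tendsto_prodFirst_top y
    rw [h0] at hlim
    obtain ⟨k, hk⟩ := (hlim.eventually (gt_mem_nhds ha)).exists
    have hk' : Tendsto (fun n => ∏ i ∈ Finset.range k, x n i) atTop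
        (𝓝 (∏ i ∈ Finset.range k, y i)) := tendsto_finsetProd _ fun i _ => hx i
    filter_upwards [hk'.eventually (gt_mem_nhds hk)] with n hn
    exact (prodFirst_top_le _ k).trans_lt hn

end Convergence

/-! ### The endogenous solution -/

theorem measurable_pi_of_forall {Ω ι β : Type*} [MeasurableSpace β] {𝓜 : MeasurableSpace Ω}
    {f : ι → Ω → β} (h : ∀ i, Measurable[𝓜] (f i)) : Measurable[𝓜] (fun ω i => f i ω) :=
  measurable_pi_lambda _ h

theorem measurable_iter_const {Ω : Type*} (N : List ℕ → Ω → ℕ∞) (m : I) (n : ℕ) (u : List ℕ) :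
    Measurable[blockSigma N {v | u <+: v}]
      fun ω => iter (fun v => N v ω) (fun _ => m) n u :=
  measurable_iter _ (x := fun _ _ => m) n u (fun _ hv _ => measurable_blockSigma N hv)
    fun _ _ _ => measurable_const

section Tree

variable {Ω : Type*} [MeasurableSpace Ω] {P : Measure Ω} [IsProbabilityMeasure P]
  {d : ProbabilityMeasure ℕ∞} {N : List ℕ → Ω → ℕ∞} {m : I}

/-- The filtration generated by the family sizes in the first levels of the tree. -/
def levelFiltration {N : List ℕ → Ω → ℕ∞} (hN : ∀ u, Measurable (N u)) :
    Filtration ℕ (inferInstance : MeasurableSpace Ω) where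
  seq n := blockSigma N {v | v.length < n}
  mono' _ _ hij := blockSigma_mono N fun _ hv => lt_of_lt_of_le hv hij
  le' n := blockSigma_le hN {v | v.length < n}

theorem iSup_levelFiltration (hN : ∀ u, Measurable (N u)) :
    ⨆ n, levelFiltration hN n = ⨆ v, MeasurableSpace.comap (N v) inferInstance := by
  refine le_antisymm (iSup_le fun n => iSup₂_le fun v _ => le_iSup
    (fun v => MeasurableSpace.comap (N v) inferInstance) v) (iSup_le fun v => ?_)
  exact le_iSup_of_le (v.length + 1) (measurable_blockSigma N
    (S := {w | w.length < v.length + 1}) (Nat.lt_succ_self v.length)).comap_le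

theorem map_iter_const (hN : ∀ u, Measurable (N u))
    (hNlaw : ∀ u, P.map (N u) = (d : Measure ℕ∞)) (hNind : iIndepFun N P) (n : ℕ) (u : List ℕ) :
    P.map (fun ω => iter (fun v => N v ω) (fun _ => m) n u) =
      ((distMap d)^[n] (diracProba m) : ProbabilityMeasure I) := by
  induction n generalizing u with
  | zero => simp only [iter, Measure.map_const, measure_univ, one_smul]; rfl
  | succ n ih =>
    rw [Function.iterate_succ_apply']
    have hY := fun i : ℕ => measurable_iter_const N m n (u ++ [i])
    refine map_step_eq_distMap (Y := fun i ω => iter (fun v => N v ω) (fun _ => m) n (u ++ [i]))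
      (hN u) (fun i => (hY i).mono (blockSigma_le hN _) le_rfl) (hNlaw u) (fun i => ih _)
      (iIndepFun_of_blocks hN hNind (pairwise_disjoint_prefix_daughters u) hY) ?_
    refine indepFun_of_blocks hN hNind (S := {u}) (T := {w | u.length < w.length}) ?_
      (measurable_blockSigma N rfl) (measurable_pi_of_forall fun i => ?_)
    · simp
    · refine (hY i).mono (blockSigma_mono N fun w hw => ?_) le_rfl
      have := List.IsPrefix.length_le hw
      rw [List.length_append, List.length_singleton] at this
      exact this

theorem moment_diracProba (m : I) (k : ℕ) : moment (diracProba m) k = m ^ k := by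
  refine Subtype.ext ?_
  rw [coe_moment]
  change ∫ x : I, (x : ℝ) ^ k ∂(Measure.dirac m) = _
  rw [integral_dirac]
  rfl

theorem integral_iter_const_pow (hN : ∀ u, Measurable (N u))
    (hNlaw : ∀ u, P.map (N u) = (d : Measure ℕ∞)) (hNind : iIndepFun N P) (n : ℕ) (u : List ℕ)
    (k : ℕ) : ∫ ω, (iter (fun v => N v ω) (fun _ => m) n u : ℝ) ^ k ∂P =
      moment ((distMap d)^[n] (diracProba m)) k :=
  (coe_moment_of_coe_eq_map ((measurable_iter_const N m n u).mono (blockSigma_le hN _) le_rfl)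
    (map_iter_const hN hNlaw hNind n u).symm k).symm

theorem expect_iter_const (hm1 : (m : ℝ) < 1) (hm : (m : ℝ) = 1 - pgf d m)
    (hN : ∀ u, Measurable (N u))
    (hNlaw : ∀ u, P.map (N u) = (d : Measure ℕ∞)) (hNind : iIndepFun N P) (n : ℕ) (u : List ℕ) :
    expect P (fun ω => iter (fun v => N v ω) (fun _ => m) n u) = m := by
  have h := integral_iter_const_pow (m := m) hN hNlaw hNind n u 1
  rw [moment_one_iterate hm1 hm (by rw [moment_diracProba, pow_one])] at h
  simp only [pow_one] at h
  exact Subtype.ext h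

/-- Adding a level replaces each constant $m$ at depth $n$ by an independent one-step value, again
of mean $m$. The approximations thus form a bounded martingale. -/
theorem exists_tendsto_iter_const_root (hm1 : (m : ℝ) < 1) (hm : (m : ℝ) = 1 - pgf d m)
    (hN : ∀ u, Measurable (N u)) (hNlaw : ∀ u, P.map (N u) = (d : Measure ℕ∞))
    (hNind : iIndepFun N P) :
    ∀ᵐ ω ∂P, ∃ c : ℝ, Tendsto (fun n => (iter (fun v => N v ω) (fun _ => m) n [] : ℝ)) atTop
      (𝓝 c) := by
  set M : ℕ → Ω → ℝ := fun n ω => iter (fun v => N v ω) (fun _ => m) n [] with hM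
  have hMm : ∀ n, Measurable[levelFiltration hN n]
      fun ω => iter (fun v => N v ω) (fun _ => m) n [] := fun n =>
    measurable_iter _ (x := fun _ _ => m) n []
      (fun v _ hv => measurable_blockSigma N (by simpa using hv)) (fun _ _ _ => measurable_const)
  have hmart : Martingale M (levelFiltration hN) P := by
    refine martingale_nat (fun n => (measurable_subtype_coe.comp (hMm n)).stronglyMeasurable)
      (fun n => integrable_coe_unitInterval ((hMm n).mono ((levelFiltration hN).le n) le_rfl))
      fun n => ?_
    have hZm : ∀ v, Measurable fun ω => iter (fun v => N v ω) (fun _ => m) 1 v := fun v =>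
      (measurable_iter_const N m 1 v).mono (blockSigma_le hN _) le_rfl
    have hZb : ∀ v, Measurable[blockSigma N {v}]
        fun ω => iter (fun v => N v ω) (fun _ => m) 1 v := fun v =>
      measurable_iter _ (x := fun _ _ => m) 1 v
        (fun w hw hl => measurable_blockSigma N (S := {v})
          (hw.eq_of_length_le (Nat.lt_succ_iff.1 hl)).symm)
        fun _ _ _ => measurable_const
    have := condExp_iter (P := P) (m := m)
      (Z := fun v ω => iter (fun v => N v ω) (fun _ => m) 1 v) hZm hN n
      (iIndepFun_of_blocks hN hNind (S := fun v : {v : List ℕ // v.length = n} => {v.1})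
        (fun v w hvw => by simpa [Function.onFun, Subtype.ext_iff] using hvw) fun v => hZb v)
      (fun v _ => expect_iter_const hm1 hm hN hNlaw hNind 1 v) ?_
    · refine this.symm.trans (EventuallyEq.of_eq ?_)
      congr 1
      funext ω
      simp only [hM, iter_succ_eq _ _ n]
      rfl
    · refine indepFun_of_blocks hN hNind (S := {v | v.length = n}) (T := {v | v.length < n}) ?_
        (measurable_pi_of_forall fun v => (hZb v).mono
          (blockSigma_mono N (Set.singleton_subset_iff.2 v.2)) le_rfl)
        (measurable_pi_of_forall fun v => measurable_blockSigma N v.2)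
      rw [Set.disjoint_left]
      intro v hv hv'
      exact hv'.ne hv
  refine hmart.submartingale.exists_ae_tendsto_of_bdd (R := 1) fun n => ?_
  refine (eLpNorm_le_of_ae_bound (C := 1) (ae_of_all _ fun ω => ?_)).trans (by simp)
  rw [Real.norm_of_nonneg (unitInterval.nonneg _)]
  exact unitInterval.le_one _

/-- The limit of the recursion run from the constant `m` in the far levels. -/
noncomputable def limitSolution {Ω : Type*} (N : List ℕ → Ω → ℕ∞) (m : I) (u : List ℕ) (ω : Ω) : I :=
  limsup (fun n => iter (fun v => N v ω) (fun _ => m) n u) atTop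

theorem measurable_limitSolution {Ω : Type*} (N : List ℕ → Ω → ℕ∞) (m : I) (u : List ℕ) :
    Measurable[blockSigma N {v | u <+: v}] (limitSolution N m u) :=
  Measurable.limsup (mδ := blockSigma N {v | u <+: v}) fun n => measurable_iter_const N m n u

/-- The subtree at $u$ carries a family with the same joint properties, so the root case applies
after a shift. -/
theorem ae_tendsto_limitSolution (hm1 : (m : ℝ) < 1) (hm : (m : ℝ) = 1 - pgf d m)
    (hN : ∀ u, Measurable (N u)) (hNlaw : ∀ u, P.map (N u) = (d : Measure ℕ∞))
    (hNind : iIndepFun N P) (u : List ℕ) :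
    ∀ᵐ ω ∂P, Tendsto (fun n => iter (fun v => N v ω) (fun _ => m) n u) atTop
      (𝓝 (limitSolution N m u ω)) := by
  have h := exists_tendsto_iter_const_root (N := fun v => N (u ++ v)) hm1 hm (fun v => hN _)
    (fun v => hNlaw _) (hNind.precomp (List.append_right_injective u))
  filter_upwards [h] with ω ⟨c, hc⟩
  have hcI : c ∈ Set.Icc (0 : ℝ) 1 :=
    isClosed_Icc.mem_of_tendsto hc (Eventually.of_forall fun n => Subtype.property _)
  have hlim : Tendsto (fun n => iter (fun v => N v ω) (fun _ => m) n u) atTop (𝓝 ⟨c, hcI⟩) := by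
    rw [tendsto_subtype_rng]
    refine hc.congr fun n => ?_
    rw [← iter_append (fun v => N v ω) (fun _ => m) n u [], List.append_nil]
  rw [limitSolution, hlim.limsup_eq]
  exact hlim

theorem isEndogenousSolution_limitSolution (hm1 : (m : ℝ) < 1) (hm : (m : ℝ) = 1 - pgf d m)
    (hN : ∀ u, Measurable (N u)) (hNlaw : ∀ u, P.map (N u) = (d : Measure ℕ∞))
    (hNind : iIndepFun N P) : IsEndogenousSolution P N (limitSolution N m) := by
  have hCb := measurable_limitSolution N m
  have hC : ∀ u, Measurable (limitSolution N m u) := fun u =>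
    (hCb u).mono (blockSigma_le hN _) le_rfl
  have hlim := ae_tendsto_limitSolution hm1 hm hN hNlaw hNind
  have hIm : ∀ n u, Measurable fun ω => iter (fun v => N v ω) (fun _ => m) n u := fun n u =>
    (measurable_iter_const N m n u).mono (blockSigma_le hN _) le_rfl
  have hmom := fun u k => tendsto_integral_pow (fun n => hIm n u) (hlim u) k
  simp_rw [fun n u k => integral_iter_const_pow (m := m) hN hNlaw hNind n u k] at hmom
  have hexp : ∀ u, expect P (limitSolution N m u) = m := by
    intro u
    have h1 := hmom u 1
    simp_rw [moment_one_iterate hm1 hm (ν := diracProba m) (by rw [moment_diracProba, pow_one]),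
      pow_one] at h1
    exact Subtype.ext (tendsto_nhds_unique h1 tendsto_const_nhds)
  refine ⟨⟨hC, fun n => ?_, fun n => ?_, fun u => ?_, fun u => ?_⟩, fun u => ?_⟩
  · exact iIndepFun_of_blocks hN hNind
      (S := fun u : {u : List ℕ // u.length = n} => {v | u.1 <+: v})
      (fun u v huv => disjoint_prefix (u.2.trans v.2.symm) fun h => huv (Subtype.ext h))
      fun u => hCb u
  · refine indepFun_of_blocks hN hNind (S := {v | n ≤ v.length}) (T := {v | v.length < n}) ?_
      (measurable_pi_of_forall fun u => (hCb u).mono (blockSigma_mono N fun v hv => ?_) le_rfl)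
      (measurable_pi_of_forall fun v => measurable_blockSigma N v.2)
    · rw [Set.disjoint_left]
      intro v hv hv'
      exact absurd (show n ≤ v.length from hv) (not_le.2 hv')
    · exact u.2.symm.le.trans (List.IsPrefix.length_le hv)
  · have hind : iIndepFun (fun (i : ℕ) => limitSolution N m (u ++ [i])) P :=
      iIndepFun_of_blocks hN hNind (pairwise_disjoint_prefix_daughters u) fun i => hCb _
    -- Passing to the limit in the recursion is delicate only for infinite families. There the
    -- product of the limits has mean $m^\infty=0$, hence vanishes almost surely.
    have hzero : ∀ᵐ ω ∂P, prodFirst ⊤ (fun i => limitSolution N m (u ++ [i]) ω) = 0 := by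
      have h0 := integral_prodFirst (fun i => hC (u ++ [i])) hind ⊤
      simp_rw [hexp, prodFirst_top_const hm1] at h0
      have h1 := (integral_eq_zero_iff_of_nonneg (fun ω => unitInterval.nonneg _)
        (integrable_coe_unitInterval ((measurable_prodFirst_apply ⊤).comp
          (measurable_pi_of_forall fun i => hC (u ++ [i]))))).1 h0
      filter_upwards [h1] with ω hω
      exact Subtype.ext hω
    filter_upwards [hzero, hlim u, ae_all_iff.2 fun i : ℕ => hlim (u ++ [i])] with ω h0 hu hi
    refine tendsto_nhds_unique ((tendsto_add_atTop_iff_nat 1).2 hu) ?_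
    refine (unitInterval.continuous_symm.tendsto _).comp
      (tendsto_prodFirst_of_tendsto hi fun h => ?_)
    rw [h]
    exact h0
  · have hprob := fun u => Measure.isProbabilityMeasure_map (μ := P) (hC u).aemeasurable
    let law : List ℕ → ProbabilityMeasure I := fun u => ⟨P.map (limitSolution N m u), hprob u⟩
    have heq : law u = law [] := by
      refine eq_of_moment_eq fun k => Subtype.ext ?_
      rw [coe_moment_of_coe_eq_map (ν := law u) (hC u) rfl,
        coe_moment_of_coe_eq_map (ν := law []) (hC []) rfl]
      exact tendsto_nhds_unique (hmom u k) (hmom [] k)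
    exact congrArg Subtype.val heq
  · refine ⟨limitSolution N m u, ?_, EventuallyEq.rfl⟩
    exact (hCb u).mono (iSup₂_le fun v _ => le_iSup
      (fun v => MeasurableSpace.comap (N v) inferInstance) v) le_rfl

theorem IsTreeSolution.distMap_eq {X : List ℕ → Ω → I} (hX : IsTreeSolution P N X)
    (hN : ∀ u, Measurable (N u)) (hNlaw : ∀ u, P.map (N u) = (d : Measure ℕ∞))
    {ς : ProbabilityMeasure I} (hς : (ς : Measure I) = P.map (X [])) : distMap d ς = ς := by
  refine Subtype.ext ?_
  have h1 : iIndepFun (fun (i : ℕ) => X ([] ++ [i])) P :=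
    (hX.indep_level 1).precomp
      (g := fun i : ℕ => (⟨[i], rfl⟩ : {u : List ℕ // u.length = 1})) fun i j h => by
        simpa using h
  have h2 : IndepFun (N []) (fun ω (i : ℕ) => X ([] ++ [i]) ω) P :=
    (hX.indep_above 1).symm.comp
      (φ := fun η : {v : List ℕ // v.length < 1} → ℕ∞ => η ⟨[], Nat.zero_lt_one⟩)
      (ψ := fun (ζ : {v : List ℕ // v.length = 1} → I) (i : ℕ) => ζ ⟨[i], rfl⟩)
      (by fun_prop) (by fun_prop)
  have h := map_step_eq_distMap (hN []) (fun i => hX.measurable ([] ++ [i])) (hNlaw [])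
    (fun i => (hX.stationary _).trans hς.symm) h1 h2
  exact h.symm.trans ((Measure.map_congr (EventuallyEq.symm (hX.recursion []))).trans hς.symm)

/-- A solution is reproduced by running the recursion from its own values at level $n$, so
`condExp_iter` applies to it. -/
theorem IsTreeSolution.condExp_root {X : List ℕ → Ω → I} (hX : IsTreeSolution P N X)
    (hN : ∀ u, Measurable (N u)) (hmean : expect P (X []) = m) (n : ℕ) :
    P[fun ω => (X [] ω : ℝ) | levelFiltration hN n] =ᵐ[P]
      fun ω => (iter (fun v => N v ω) (fun _ => m) n [] : ℝ) := by
  have hexp : ∀ u, expect P (X u) = m := by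
    intro u
    rw [← hmean]
    refine Subtype.ext ?_
    have hmap : ∀ u, (expect P (X u) : ℝ) = ∫ x : I, (x : ℝ) ∂(P.map (X u)) := fun u =>
      (integral_map (hX.measurable u).aemeasurable (by fun_prop)).symm
    rw [hmap, hmap, hX.stationary]
  refine (condExp_congr_ae ?_).trans (condExp_iter hX.measurable hN n (hX.indep_level n)
    (fun u _ => hexp u) (hX.indep_above n))
  filter_upwards [ae_all_iff.2 hX.recursion] with ω hω
  rw [iter_eq_self (N := fun v => N v ω) (x := fun v => X v ω) hω]

/-- Lévy's upward theorem; endogeny makes the limiting conditional expectation the root value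
itself. -/
theorem IsEndogenousSolution.ae_tendsto_root {X : List ℕ → Ω → I}
    (hX : IsEndogenousSolution P N X) (hN : ∀ u, Measurable (N u)) (hmean : expect P (X []) = m) :
    ∀ᵐ ω ∂P, Tendsto (fun n => iter (fun v => N v ω) (fun _ => m) n []) atTop (𝓝 (X [] ω)) := by
  obtain ⟨Y, hY, hXY⟩ := hX.endogenous []
  rw [← iSup_levelFiltration hN] at hY
  have hle : (⨆ n, levelFiltration hN n) ≤ (inferInstance : MeasurableSpace Ω) :=
    iSup_le (levelFiltration hN).le
  have hXYr : (fun ω => (X [] ω : ℝ)) =ᵐ[P] fun ω => (Y ω : ℝ) := by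
    filter_upwards [hXY] with ω hω
    rw [hω]
  have hYc := condExp_of_stronglyMeasurable (μ := P) hle
    (measurable_subtype_coe.comp hY).stronglyMeasurable
    (integrable_coe_unitInterval (hY.mono hle le_rfl))
  filter_upwards [tendsto_ae_condExp (ℱ := levelFiltration hN) (μ := P) (fun ω => (Y ω : ℝ)), hXY,
    ae_all_iff.2 fun n => (condExp_congr_ae hXYr).symm.trans
      (hX.toIsTreeSolution.condExp_root hN hmean n)] with ω h1 h2 h3
  rw [tendsto_subtype_rng, h2]
  have h4 : (P[fun ω => (Y ω : ℝ) | ⨆ n, levelFiltration hN n]) ω = Y ω := congrFun hYc ω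
  simp_rw [h3, h4] at h1
  exact h1

/-- The second moment of the root is the limit of those of $\mathcal T^n(\delta_m)$, which stay
below some $b<m$, whereas the two-point law has second moment $m$. -/
theorem IsEndogenousSolution.ne_twoPoint {X : List ℕ → Ω → I}
    (hX : IsEndogenousSolution P N X) (hH0 : pgf d 0 = 0)
    (hconv : StrictConvexOn ℝ (Set.Icc 0 1) (pgf d)) (hm1 : (m : ℝ) < 1)
    (hm : (m : ℝ) = 1 - pgf d m) (hunst : 1 < deriv (pgf d) (m : ℝ))
    (hN : ∀ u, Measurable (N u)) (hNlaw : ∀ u, P.map (N u) = (d : Measure ℕ∞))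
    (hNind : iIndepFun N P) {ς : ProbabilityMeasure I}
    (hς : (ς : Measure I) = P.map (X [])) : ς ≠ twoPoint m := by
  have hm0 : 0 < (m : ℝ) := by
    refine lt_of_le_of_ne m.2.1 fun h => ?_
    rw [← h, hH0] at hm
    norm_num at hm
  have hς1 : moment ς 1 = m := moment_one_eq_of_distMap_eq hconv hm
    (hX.toIsTreeSolution.distMap_eq hN hNlaw hς)
  have hmom := coe_moment_of_coe_eq_map (hX.measurable []) hς
  have hmean : expect P (X []) = m := by
    rw [← hς1]
    refine Subtype.ext ?_
    simp only [hmom, pow_one]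
    rfl
  obtain ⟨b, hbm, hb⟩ := exists_moment_two_iterate_le hm0 hm1 hm hunst
  have hlim := tendsto_integral_pow (fun n => (measurable_iter_const N m n []).mono
    (blockSigma_le hN _) le_rfl) (hX.ae_tendsto_root hN hmean) 2
  simp_rw [fun n => integral_iter_const_pow (m := m) hN hNlaw hNind n [] 2] at hlim
  have hle := le_of_tendsto' hlim (hb (diracProba m) (by rw [moment_diracProba, pow_one])
    (by rw [moment_diracProba]; rfl))
  rw [← hmom] at hle
  rintro rfl
  rw [moment_twoPoint m two_ne_zero] at hle
  exact absurd hbm (not_lt.2 hle)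

end Tree

end VetoVoter

/-! ### The basin of the endogenous law -/

theorem theorem5p3 {Ω : Type*} [MeasurableSpace Ω] (P : Measure Ω) [IsProbabilityMeasure P]
    (d : ProbabilityMeasure ℕ∞)
    (hH0 : VetoVoter.pgf d 0 = 0)
    (hHconvex : StrictConvexOn ℝ (Set.Icc 0 1) (VetoVoter.pgf d))
    (N : List ℕ → Ω → ℕ∞)
    (hNmeas : ∀ u, Measurable (N u))
    (hNlaw : ∀ u, P.map (N u) = (d : Measure ℕ∞))
    (hNindep : iIndepFun N P)
    (μ₁ : unitInterval)
    (hμ₁ : VetoVoter.distMap d (VetoVoter.twoPoint μ₁) = VetoVoter.twoPoint μ₁)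
    (hunstable : 1 < deriv (VetoVoter.pgf d) (μ₁ : ℝ)) :
    (∃ C : List ℕ → Ω → unitInterval, VetoVoter.IsEndogenousSolution P N C) ∧
    ∀ C : List ℕ → Ω → unitInterval, VetoVoter.IsEndogenousSolution P N C →
      ∀ ς : ProbabilityMeasure unitInterval, (ς : Measure unitInterval) = P.map (C []) →
        VetoVoter.basin d ς =
          {ν : ProbabilityMeasure unitInterval |
            ∫ x, (x : ℝ) ∂(ν : Measure unitInterval) = (μ₁ : ℝ) ∧
              ν ≠ VetoVoter.twoPoint μ₁} := by
  obtain ⟨hm1, hm⟩ := VetoVoter.mean_twoPoint_fixed hμ₁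
  refine ⟨⟨_, VetoVoter.isEndogenousSolution_limitSolution hm1 hm hNmeas hNlaw hNindep⟩,
    fun C hC ς hς => ?_⟩
  rw [VetoVoter.basin_eq_of_distMap_eq hH0 hHconvex hμ₁ hunstable
    (hC.toIsTreeSolution.distMap_eq hNmeas hNlaw hς)
    (hC.ne_twoPoint hH0 hHconvex hm1 hm hunstable hNmeas hNlaw hNindep hς)]
  ext ν
  simp only [Set.mem_ofPred_eq, ← Subtype.coe_inj (a := VetoVoter.moment ν 1),
    VetoVoter.coe_moment, pow_one]
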